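/- For a finite-dimensional complex Lie algebra $\mathfrak g$ and a linear form $f\in\mathfrak g^*$, let $\mathfrak g_f=\{x\in\mathfrak g : f([x,y])=0 \text{ for all } y\in\mathfrak g\}$; the index of $\mathfrak g$ is $$\chi[\mathfrak g]=\min\{\dim\mathfrak g_f : f\in\mathfrak g^*\}.$$ For a composition $(a_1,\dots,a_k)$ of $n$ (positive integers with sum $n$), let $\mathfrak p(a_1,\dots,a_k)\subseteq\mathfrak{gl}(n)=\mathfrak{gl}(n,\mathbb C)$ be the parabolic subalgebra, unique up to conjugation, consisting of the block upper triangular matrices with diagonal blocks of sizes $a_1,\dots,a_k$ in this order. Write $a\wedge b$ for the greatest common divisor of $a$ and $b$, and $[x]$ for the integer part of $x$. For $m\ge 1$ and positive integers $x,y$ that are not both even, put $$\phi_m(x,y)=\begin{cases}[\frac m2]+1 & \text{if } x \text{ and } y \text{ are odd},\\ [\frac{m+1}2] & \text{if } x \text{ is odd and } y \text{ is even},\\ 1 & \text{if } x \text{ is even and } y \text{ is odd}.\end{cases}$$ Then for all positive integers $a,b,m$, $$\chi[\mathfrak p(\underbrace{a,\dots,a}_{m},b)]=(a\wedge b)\,\phi_m\!\left(\frac{a}{a\wedge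 b},\frac{b}{a\wedge b}\right).$$ -/

import Mathlib

/-- The stabilizer `{x | ∀ y, f ⁅x, y⁆ = 0}` of a linear form `f` on a Lie algebra `L` for the
coadjoint action. -/
def coadjointStabilizer (K : Type*) {L : Type*} [Field K] [LieRing L] [LieAlgebra K L]
    (f : Module.Dual K L) : LieSubalgebra K L where
  carrier := {x | ∀ y : L, f ⁅x, y⁆ = 0}
  add_mem' := by
    intro x y hx hy z
    rw [add_lie, map_add, hx z, hy z, add_zero]
  zero_mem' := by
    intro z
    rw [zero_lie, map_zero]
  smul_mem' := by
    intro c x hx z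
    rw [smul_lie, map_smul, hx z, smul_zero]
  lie_mem' := by
    intro x y hx hy z
    rw [lie_lie, map_sub, hx, hy, sub_zero]

/-- The index of a finite-dimensional Lie algebra `L`: the minimal dimension of the stabilizer
of a linear form on `L`. -/
noncomputable def lieIndex (K L : Type*) [Field K] [LieRing L] [LieAlgebra K L] : ℕ :=
  sInf {d : ℕ | ∃ f : Module.Dual K L, Module.finrank K (coadjointStabilizer K f) = d}

-- `Matrix (Fin n) (Fin n) ℂ` is regarded as the Lie algebra `𝔤𝔩(n)` with bracket `M * N - N * M`.
attribute [local instance 100] LieRing.ofAssociativeRing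

/-- The standard parabolic subalgebra of `𝔤𝔩(n)` over `ℂ` attached to a composition `c` of `n`: the
block upper triangular matrices whose diagonal blocks have the sizes given by `c`, in this order.
Here `c.index i` is the block containing the position `i`. -/
def parabolic {n : ℕ} (c : Composition n) : LieSubalgebra ℂ (Matrix (Fin n) (Fin n) ℂ) where
  carrier := {M | M.BlockTriangular c.index}
  add_mem' := fun hM hN => hM.add hN
  zero_mem' := Matrix.blockTriangular_zero
  smul_mem' := by
    intro z M hM i j hij
    rw [Matrix.smul_apply, hM hij, smul_zero]
  lie_mem' := by
    intro M N hM hN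
    exact (hM.mul hN).sub (hN.mul hM)

/-- The composition `(a, …, a, b)` of `m * a + b`, with `m` blocks equal to `a`. -/
def repeatedComposition (a b m : ℕ) (ha : 0 < a) (hb : 0 < b) : Composition (m * a + b) where
  blocks := List.replicate m a ++ [b]
  blocks_pos := by
    intro i hi
    rcases List.mem_append.1 hi with h | h
    · rw [List.eq_of_mem_replicate h]
      exact ha
    · rw [List.mem_singleton.1 h]
      exact hb
  blocks_sum := by simp

/-- The function `φ_m`, meant for pairs `(x, y)` of positive integers that are not both even
(on pairs of even numbers the value is the irrelevant `1`). -/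
def phi (m x y : ℕ) : ℕ :=
  if Odd x then (if Odd y then m / 2 + 1 else (m + 1) / 2) else 1

/-! A linear form on the parabolic subalgebra is a trace form `y ↦ tr (F * y)`, and the proof takes
place in seaweed algebras: matrices supported on upper triangular positions inside the blocks of a
composition T and lower triangular positions inside the blocks of a composition S. The parabolic
algebra is the case where T is one block and S is (a, …, a, b).

The index of a seaweed algebra is the number of cycles of the block reversal of S followed by that
of T (`hasIncidenceIndex_seaweed`). The induction compares the sizes p and q of the first blocks of
S and T, with p ≤ q after a transposition. If p = q, a summand gl(p) of index p splits off, matching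
p fixed points. If 2p ≤ q, the pair (p, … | q, …) becomes (… | q - 2p, p, …); if p < q < 2p, it
becomes (2p - q, … | p, …). Both moves rest on a normal form: for generic F a certain minor is
invertible, can be conjugated to the identity and then used to clear its columns, and the stabilizer
that remains is that of a form on the smaller algebra (`HasIncidenceIndex.of_remove_class`,
`HasIncidenceIndex.of_remove_subclass`). Upper semicontinuity of kernel dimensions extends the lower
bound from generic F to all F. On the other side each move replaces the permutation by its first
return map to the remaining points, which keeps the number of cycles. Cycles are counted throughout
as the dimension of the space of invariant functions.

For (a, …, a, b) the permutation folds to i ↦ b - a - i + 2(i mod a) on ℤ/ma. Put d = gcd(a, b), a =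
dx, b = dy and i = k·dx + z·d + r. One step fixes r, sends z to z + y mod x and k to -k - 1 + ⌊(z +
y)/x⌋. As x and y are coprime, z runs through all residues, so there are d copies of the return map
k ↦ (-1)^x k + C on ℤ/m. For x even C = 1, which gives one cycle. For x odd this is a reflection
with C ≡ x + y mod 2, and its orbits are counted by the parity of C. -/

open Filter Topology Matrix

/-! ### Upper semicontinuity of kernel dimensions. -/

section Semicontinuity

/-- Upper semicontinuity of the dimension of the kernel along a curve of linear maps. -/
theorem le_finrank_ker_of_frequently {V W : Type*} [AddCommGroup V] [Module ℂ V]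
    [FiniteDimensional ℂ V] [NormedAddCommGroup W] [NormedSpace ℂ W]
    (L : ℂ → V →ₗ[ℂ] W) (hL : ∀ v, Continuous fun t => L t v) {n : ℕ} {t₀ : ℂ}
    (h : ∃ᶠ t in 𝓝 t₀, n ≤ Module.finrank ℂ (LinearMap.ker (L t))) :
    n ≤ Module.finrank ℂ (LinearMap.ker (L t₀)) := by
  let b := Module.finBasis ℂ (LinearMap.range (L t₀))
  have hv : ∀ i, ∃ v, L t₀ v = b i := fun i => (b i).2
  choose v hv using hv
  have hind : LinearIndependent ℂ fun i => L t₀ (v i) := by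
    have := b.linearIndependent.map' (LinearMap.range (L t₀)).subtype (Submodule.ker_subtype _)
    have e : ((LinearMap.range (L t₀)).subtype ∘ b) = fun i => L t₀ (v i) :=
      funext fun i => (hv i).symm
    rw [e] at this
    exact this
  -- Linear independence is an open condition, so the rank cannot drop near `t₀` and the kernel
  -- cannot be larger nearby than at `t₀`.
  have hev : ∀ᶠ t in 𝓝 t₀, LinearIndependent ℂ fun i => L t (v i) := by
    have hc : Continuous fun t => fun i => L t (v i) := continuous_pi fun i => hL (v i)
    exact hc.continuousAt.eventually (isOpen_setOfPred_linearIndependent.mem_nhds hind)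
  obtain ⟨t, ht, hind'⟩ := (h.and_eventually hev).exists
  have hr : Module.finrank ℂ (LinearMap.range (L t₀)) ≤ Module.finrank ℂ (LinearMap.range (L t)) := by
    have hind'' : LinearIndependent ℂ fun i => (⟨L t (v i), v i, rfl⟩ : LinearMap.range (L t)) :=
      LinearIndependent.of_comp (LinearMap.range (L t)).subtype hind'
    simpa using hind''.fintype_card_le_finrank
  have h₁ := (L t).finrank_range_add_finrank_ker
  have h₂ := (L t₀).finrank_range_add_finrank_ker
  omega

theorem frequently_nhds_zero_eval_ne_zero {p : Polynomial ℂ} (hp : p ≠ 0) :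
    ∃ᶠ t in 𝓝 (0 : ℂ), p.eval t ≠ 0 := by
  have h : ∀ᶠ t in 𝓝[≠] (0 : ℂ), p.eval t ≠ 0 := by
    have hf : (p.rootSet ℂ).Finite := p.rootSet_finite ℂ
    -- The point 0 may itself be a root, so the neighbourhood avoids only the other roots.
    have h0 : ((p.rootSet ℂ) \ {0} : Set ℂ)ᶜ ∈ 𝓝 (0 : ℂ) :=
      (hf.subset Set.sdiff_subset).isClosed.isOpen_compl.mem_nhds (by simp)
    filter_upwards [nhdsWithin_le_nhds h0, self_mem_nhdsWithin] with t ht ht0 h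
    refine ht ⟨?_, ht0⟩
    simpa [Polynomial.mem_rootSet, hp] using h
  exact h.frequently.filter_mono nhdsWithin_le_nhds

end Semicontinuity

/-! ### Stabilizers of trace forms on matrices with prescribed support. -/

section IncidenceStabilizer

variable {ι κ : Type*} [Fintype ι] [Fintype κ]

/-- The stabilizer of the linear form `y ↦ tr (F * y)` on the space of matrices supported on `R`. -/
def incidenceStabilizer (R : ι → ι → Prop) (F : Matrix ι ι ℂ) : Submodule ℂ (Matrix ι ι ℂ) where
  carrier := {x | (∀ i j, ¬ R i j → x i j = 0) ∧ ∀ i j, R j i → (x * F - F * x) i j = 0}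
  zero_mem' := by simp
  add_mem' := by
    rintro x y ⟨hx, hx'⟩ ⟨hy, hy'⟩
    refine ⟨fun i j h => by simp [hx i j h, hy i j h], fun i j h => ?_⟩
    have h1 := hx' i j h
    have h2 := hy' i j h
    rw [add_mul, mul_add, add_sub_add_comm, Matrix.add_apply, h1, h2, add_zero]
  smul_mem' := by
    rintro c x ⟨hx, hx'⟩
    refine ⟨fun i j h => by simp [hx i j h], fun i j h => ?_⟩
    have h1 := hx' i j h
    rw [smul_mul_assoc, mul_smul_comm, ← smul_sub, Matrix.smul_apply, h1, smul_zero]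

theorem mem_incidenceStabilizer {R : ι → ι → Prop} {F x : Matrix ι ι ℂ} :
    x ∈ incidenceStabilizer R F ↔
      (∀ i j, ¬ R i j → x i j = 0) ∧ ∀ i j, R j i → (x * F - F * x) i j = 0 := Iff.rfl

/-- The minimal dimension of `incidenceStabilizer R F` is `n`. -/
def HasIncidenceIndex (R : ι → ι → Prop) (n : ℕ) : Prop :=
  (∃ F, Module.finrank ℂ (incidenceStabilizer R F) ≤ n) ∧
    ∀ F, n ≤ Module.finrank ℂ (incidenceStabilizer R F)

/-- The stabilizers are kernels of a family of linear maps that is continuous in t. Lower bounds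
therefore need proof only at points of some line through `F₀` that accumulate at `F₀`. -/
theorem le_finrank_incidenceStabilizer_of_frequently {R : ι → ι → Prop} {F₀ F₁ : Matrix ι ι ℂ}
    {n : ℕ} (h : ∃ᶠ t in 𝓝 (0 : ℂ), n ≤ Module.finrank ℂ (incidenceStabilizer R (F₀ + t • F₁))) :
    n ≤ Module.finrank ℂ (incidenceStabilizer R F₀) := by
  classical
  let L : ℂ → Matrix ι ι ℂ →ₗ[ℂ] ((ι → ι → ℂ) × (ι → ι → ℂ)) := fun t =>
    { toFun := fun x => (fun i j => if R i j then 0 else x i j,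
        fun i j => if R j i then (x * (F₀ + t • F₁) - (F₀ + t • F₁) * x) i j else 0)
      map_add' := by
        intro x y
        ext i j
        · by_cases h : R i j <;> simp [h]
        · by_cases h : R j i <;> simp [h, add_mul, mul_add]
          ring
      map_smul' := by
        intro c x
        ext i j
        · by_cases h : R i j <;> simp [h]
        · by_cases h : R j i <;> simp [h, mul_add, add_mul]
          ring }
  have hker : ∀ t, LinearMap.ker (L t) = incidenceStabilizer R (F₀ + t • F₁) := by
    intro t
    ext x
    simp only [LinearMap.mem_ker, L, LinearMap.coe_mk, AddHom.coe_mk, Prod.mk_eq_zero,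
      mem_incidenceStabilizer, funext_iff, Pi.zero_apply]
    refine and_congr ?_ ?_ <;> refine forall_congr' fun i => forall_congr' fun j => ?_ <;>
      split_ifs <;> simp_all
  have hcont : ∀ x, Continuous fun t => L t x := by
    intro x
    refine Continuous.prodMk continuous_const ?_
    refine continuous_pi fun i => continuous_pi fun j => ?_
    split_ifs
    · simp only [Matrix.sub_apply, Matrix.mul_apply, Matrix.add_apply, Matrix.smul_apply, smul_eq_mul]
      fun_prop
    · exact continuous_const
  have := le_finrank_ker_of_frequently L hcont (n := n) (t₀ := 0) (by
    refine h.mono fun t ht => ?_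
    rw [hker]
    exact ht)
  rwa [hker, zero_smul, add_zero] at this

/-- Only the entries `F i j` with `R j i` pair with matrices supported on `R`. Transitivity ensures
that the tested commutator entries involve no others: `R j i` and `R i l` give `R j l`. -/
theorem incidenceStabilizer_congr {R : ι → ι → Prop} (hR : ∀ i j k, R i j → R j k → R i k)
    {F F' : Matrix ι ι ℂ} (h : ∀ i j, R j i → F i j = F' i j) :
    incidenceStabilizer R F = incidenceStabilizer R F' := by
  ext x
  rw [mem_incidenceStabilizer, mem_incidenceStabilizer]
  refine and_congr_right fun hx => forall_congr' fun i => forall_congr' fun j =>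
    imp_congr_right fun hji => ?_
  rw [Matrix.sub_apply, Matrix.sub_apply, Matrix.mul_apply, Matrix.mul_apply, Matrix.mul_apply,
    Matrix.mul_apply]
  have h₁ : ∀ l, x i l * F l j = x i l * F' l j := fun l => by
    by_cases hil : R i l
    · rw [h l j (hR _ _ _ hji hil)]
    · rw [hx i l hil, zero_mul, zero_mul]
  have h₂ : ∀ l, F i l * x l j = F' i l * x l j := fun l => by
    by_cases hlj : R l j
    · rw [h i l (hR _ _ _ hlj hji)]
    · rw [hx l j hlj, mul_zero, mul_zero]
  simp only [h₁, h₂]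

theorem mul_apply_eq_zero_of_not_rel {R : ι → ι → Prop} (hR : ∀ i j k, R i j → R j k → R i k)
    {x y : Matrix ι ι ℂ} (hx : ∀ i j, ¬ R i j → x i j = 0) (hy : ∀ i j, ¬ R i j → y i j = 0)
    (i j : ι) (h : ¬ R i j) : (x * y) i j = 0 := by
  rw [Matrix.mul_apply]
  refine Finset.sum_eq_zero fun l _ => ?_
  by_cases hil : R i l
  · rw [hy l j fun hlj => h (hR _ _ _ hil hlj), mul_zero]
  · rw [hx i l hil, zero_mul]

/-- This is the coadjoint action of the unit group of the incidence algebra: `x ↦ g' * x * g`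
carries one stabilizer injectively into the other. -/
theorem finrank_incidenceStabilizer_conj_le [DecidableEq ι] {R : ι → ι → Prop}
    (hR : ∀ i j k, R i j → R j k → R i k) {F g g' : Matrix ι ι ℂ}
    (hg : ∀ i j, ¬ R i j → g i j = 0) (hg' : ∀ i j, ¬ R i j → g' i j = 0) (hgg' : g * g' = 1) :
    Module.finrank ℂ (incidenceStabilizer R (g * F * g')) ≤
      Module.finrank ℂ (incidenceStabilizer R F) := by
  have hg'g : g' * g = 1 := mul_eq_one_comm.1 hgg'
  let T : incidenceStabilizer R (g * F * g') →ₗ[ℂ] incidenceStabilizer R F :=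
    ((LinearMap.mulLeft ℂ g' ∘ₗ LinearMap.mulRight ℂ g) ∘ₗ
      (incidenceStabilizer R (g * F * g')).subtype).codRestrict _ (by
      rintro ⟨x, hx, hx'⟩
      refine ⟨?_, ?_⟩
      · exact mul_apply_eq_zero_of_not_rel hR hg' (mul_apply_eq_zero_of_not_rel hR hx hg)
      · intro i j hji
        have key : g' * (x * g) * F - F * (g' * (x * g)) =
            g' * (x * (g * F * g') - g * F * g' * x) * g := by
          have h1 : g' * (x * (g * F * g')) * g = g' * (x * g) * F * (g' * g) := by
            simp only [mul_assoc]
          have h2 : g' * (g * F * g' * x) * g = (g' * g) * (F * (g' * (x * g))) := by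
            simp only [mul_assoc]
          rw [mul_sub, sub_mul, h1, h2, hg'g, mul_one, one_mul]
        simp only [LinearMap.coe_comp, Function.comp_apply, Submodule.coe_subtype,
          LinearMap.mulLeft_apply, LinearMap.mulRight_apply]
        rw [key, Matrix.mul_apply]
        refine Finset.sum_eq_zero fun l _ => ?_
        by_cases hlj : R l j
        · rw [Matrix.mul_apply, Finset.sum_eq_zero, zero_mul]
          intro k _
          by_cases hik : R i k
          · rw [hx' k l (hR _ _ _ hlj (hR _ _ _ hji hik)), mul_zero]
          · rw [hg' i k hik, zero_mul]
        · rw [hg l j hlj, mul_zero])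
  refine LinearMap.finrank_le_finrank_of_injective (f := T) ?_
  rintro ⟨x, hx⟩ ⟨y, hy⟩ h
  have h' : g' * (x * g) = g' * (y * g) := congrArg Subtype.val h
  have : g * (g' * (x * g)) * g' = g * (g' * (y * g)) * g' := by rw [h']
  simp only [mul_assoc, hgg', mul_one] at this
  simp only [← mul_assoc, hgg', one_mul] at this
  exact Subtype.ext this

/-- Two maps on forms that do not increase stabilizer dimensions suffice; they need be neither
linear nor mutually inverse. -/
theorem HasIncidenceIndex.of_submodule_equiv {R : ι → ι → Prop} {R' : κ → κ → Prop} {n : ℕ}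
    (φ : Matrix κ κ ℂ → Matrix ι ι ℂ) (ψ : Matrix ι ι ℂ → Matrix κ κ ℂ)
    (hφ : ∀ F, Module.finrank ℂ (incidenceStabilizer R (φ F)) ≤
      Module.finrank ℂ (incidenceStabilizer R' F))
    (hψ : ∀ F, Module.finrank ℂ (incidenceStabilizer R' (ψ F)) ≤
      Module.finrank ℂ (incidenceStabilizer R F))
    (h : HasIncidenceIndex R' n) : HasIncidenceIndex R n := by
  obtain ⟨⟨F, hF⟩, h⟩ := h
  exact ⟨⟨φ F, (hφ F).trans hF⟩, fun F => (h _).trans (hψ F)⟩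

/-- Transposition reverses the relation and changes the commutator only by a sign. For seaweeds it
exchanges the two compositions. -/
theorem HasIncidenceIndex.swap {R : ι → ι → Prop} {n : ℕ} (h : HasIncidenceIndex R n) :
    HasIncidenceIndex (fun i j => R j i) n := by
  have key : ∀ (S : ι → ι → Prop) (F : Matrix ι ι ℂ),
      Module.finrank ℂ (incidenceStabilizer (fun i j => S j i) Fᵀ) ≤
        Module.finrank ℂ (incidenceStabilizer S F) := by
    intro S F
    let T : incidenceStabilizer (fun i j => S j i) Fᵀ →ₗ[ℂ] incidenceStabilizer S F :=
      ((Matrix.transposeLinearEquiv ι ι ℂ ℂ).toLinearMap ∘ₗ Submodule.subtype _).codRestrict _ (by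
        rintro ⟨x, hx, hx'⟩
        refine ⟨fun i j h => hx j i h, fun i j h => ?_⟩
        have := hx' j i h
        have e : x * Fᵀ - Fᵀ * x = -(xᵀ * F - F * xᵀ)ᵀ := by
          simp [Matrix.transpose_mul]
        rw [e, Matrix.neg_apply, neg_eq_zero] at this
        exact this)
    refine LinearMap.finrank_le_finrank_of_injective (f := T) ?_
    rintro ⟨x, hx⟩ ⟨y, hy⟩ h
    exact Subtype.ext ((Matrix.transposeLinearEquiv ι ι ℂ ℂ).injective (congrArg Subtype.val h))
  exact h.of_submodule_equiv Matrix.transpose Matrix.transpose (key R)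
    (key fun i j => R j i)

theorem finrank_incidenceStabilizer_submatrix_le {R : ι → ι → Prop} {R' : κ → κ → Prop} (e : ι ≃ κ)
    (hR : ∀ i j, R i j ↔ R' (e i) (e j)) (F : Matrix κ κ ℂ) :
    Module.finrank ℂ (incidenceStabilizer R (F.submatrix e e)) ≤
      Module.finrank ℂ (incidenceStabilizer R' F) := by
  let T : incidenceStabilizer R (F.submatrix e e) →ₗ[ℂ] incidenceStabilizer R' F :=
    ((Matrix.reindexLinearEquiv ℂ ℂ e e).toLinearMap ∘ₗ Submodule.subtype _).codRestrict _ (by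
      rintro ⟨x, hx, hx'⟩
      refine ⟨fun i j h => hx _ _ (by simpa [hR] using h), fun i j h => ?_⟩
      have := hx' (e.symm i) (e.symm j) (by simpa [hR] using h)
      have e1 : x.submatrix e.symm e.symm * F - F * x.submatrix e.symm e.symm =
          (x * F.submatrix e e - F.submatrix e e * x).submatrix e.symm e.symm := by
        rw [Matrix.submatrix_sub, Pi.sub_apply, Pi.sub_apply,
          ← Matrix.submatrix_mul_equiv _ _ _ e.symm, ← Matrix.submatrix_mul_equiv _ _ _ e.symm]
        simp
      simp only [LinearMap.coe_comp, Function.comp_apply, Submodule.coe_subtype,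
        LinearEquiv.coe_coe, Matrix.coe_reindexLinearEquiv, Matrix.reindex_apply]
      rw [e1]
      exact this)
  refine LinearMap.finrank_le_finrank_of_injective (f := T) ?_
  rintro ⟨x, hx⟩ ⟨y, hy⟩ h
  exact Subtype.ext ((Matrix.reindexLinearEquiv ℂ ℂ e e).injective (congrArg Subtype.val h))

theorem HasIncidenceIndex.reindex {R : ι → ι → Prop} {R' : κ → κ → Prop} {n : ℕ} (e : ι ≃ κ)
    (hR : ∀ i j, R i j ↔ R' (e i) (e j)) (h : HasIncidenceIndex R' n) : HasIncidenceIndex R n :=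
  h.of_submodule_equiv _ _ (finrank_incidenceStabilizer_submatrix_le e hR)
    (finrank_incidenceStabilizer_submatrix_le e.symm (by simp [hR]))

end IncidenceStabilizer

/-! ### Elimination of a whole first class. -/

section Reduction

set_option linter.unusedSectionVars false

variable {P K J M : Type*} [Fintype P] [Fintype K] [Fintype J] [Fintype M]
  [DecidableEq P] [DecidableEq K] [DecidableEq J] [DecidableEq M]

/-- The matrix of the map of coordinate spaces induced by `e : P → J`. -/
def inclusionMatrix (e : P → J) : Matrix J P ℂ := Matrix.of fun j p => if j = e p then 1 else 0

theorem mul_inclusionMatrix_apply {ι : Type*} (e : P → J) (X : Matrix ι J ℂ) (i : ι) (p : P) :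
    (X * inclusionMatrix e) i p = X i (e p) := by
  simp [Matrix.mul_apply, inclusionMatrix]

theorem inclusionMatrix_mul_apply {ι : Type*} {e : P → J} (he : Function.Injective e)
    (Y : Matrix P ι ℂ) (p : P) (i : ι) : (inclusionMatrix e * Y) (e p) i = Y p i := by
  simp [Matrix.mul_apply, inclusionMatrix, he.eq_iff]

theorem inclusionMatrix_mul_apply_of_notMem {ι : Type*} {e : P → J} (Y : Matrix P ι ℂ) {j : J}
    (hj : j ∉ Set.range e) (i : ι) : (inclusionMatrix e * Y) j i = 0 := by
  rw [Matrix.mul_apply]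
  refine Finset.sum_eq_zero fun p _ => ?_
  have : j ≠ e p := fun h => hj ⟨p, h.symm⟩
  simp [inclusionMatrix, this]

theorem transpose_inclusionMatrix_mul_apply {ι : Type*} (e : P → J) (Y : Matrix J ι ℂ) (p : P)
    (i : ι) : ((inclusionMatrix e)ᵀ * Y) p i = Y (e p) i := by
  simp [Matrix.mul_apply, inclusionMatrix]

theorem mul_transpose_inclusionMatrix_apply {ι : Type*} {e : P → J} (he : Function.Injective e)
    (X : Matrix ι P ℂ) (i : ι) (p : P) : (X * (inclusionMatrix e)ᵀ) i (e p) = X i p := by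
  simp [Matrix.mul_apply, inclusionMatrix, he.eq_iff]

theorem mul_transpose_inclusionMatrix_apply_of_notMem {ι : Type*} {e : P → J} (X : Matrix ι P ℂ)
    (i : ι) {j : J} (hj : j ∉ Set.range e) : (X * (inclusionMatrix e)ᵀ) i j = 0 := by
  rw [Matrix.mul_apply]
  refine Finset.sum_eq_zero fun p _ => ?_
  have : j ≠ e p := fun h => hj ⟨p, h.symm⟩
  simp [inclusionMatrix, this]

theorem transpose_inclusionMatrix_mul_self {e : P → J} (he : Function.Injective e) :
    (inclusionMatrix e)ᵀ * inclusionMatrix e = 1 := by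
  ext p p'
  rw [mul_inclusionMatrix_apply]
  simp [inclusionMatrix, Matrix.one_apply, he.eq_iff, eq_comm]

/-- The determinant of `C + t` is the characteristic polynomial of `-C` at t, hence not identically
zero. -/
theorem frequently_isUnit_add_smul_one (C : Matrix P P ℂ) :
    ∃ᶠ t in 𝓝 (0 : ℂ), IsUnit (C + t • (1 : Matrix P P ℂ)) := by
  refine (frequently_nhds_zero_eval_ne_zero (Matrix.charpoly_monic (-C)).ne_zero).mono ?_
  intro t ht
  rw [Matrix.eval_charpoly, sub_neg_eq_add, add_comm] at ht
  rw [Matrix.isUnit_iff_isUnit_det, isUnit_iff_ne_zero, Matrix.smul_one_eq_diagonal]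
  exact ht

/-- Since no element of `B` is related to `A`, the stabilizer consists of block upper triangular
matrices and the upper right corner of the commutator is not tested. The equations are the other
three blocks. -/
theorem fromBlocks_mem_incidenceStabilizer {A B : Type*} [Fintype A] [Fintype B]
    {R : A ⊕ B → A ⊕ B → Prop} (hBA : ∀ b a, ¬ R (.inr b) (.inl a)) {u : Matrix A A ℂ}
    {v : Matrix A B ℂ} {w : Matrix B B ℂ} {Φ : Matrix A A ℂ} {Λ : Matrix B A ℂ} {G : Matrix B B ℂ} :
    fromBlocks u v 0 w ∈ incidenceStabilizer R (fromBlocks Φ 0 Λ G) ↔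
      ((∀ a a', ¬ R (.inl a) (.inl a') → u a a' = 0) ∧ (∀ a b, ¬ R (.inl a) (.inr b) → v a b = 0) ∧
        ∀ b b', ¬ R (.inr b) (.inr b') → w b b' = 0) ∧
      (∀ a a', R (.inl a') (.inl a) → (u * Φ) a a' + (v * Λ) a a' - (Φ * u) a a' = 0) ∧
      (∀ b a, R (.inl a) (.inr b) → (w * Λ) b a - (Λ * u) b a = 0) ∧
      ∀ b b', R (.inr b') (.inr b) → (w * G) b b' - ((Λ * v) b b' + (G * w) b b') = 0 := by
  rw [mem_incidenceStabilizer, fromBlocks_multiply, fromBlocks_multiply]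
  simp only [Sum.forall, hBA, not_false_eq_true, Matrix.sub_apply,
    fromBlocks_apply₁₁, fromBlocks_apply₁₂, fromBlocks_apply₂₁, fromBlocks_apply₂₂,
    Matrix.mul_zero, Matrix.zero_mul, add_zero, zero_add, Matrix.zero_apply, Matrix.add_apply,
    false_imp_iff, implies_true, true_and, and_true]
  constructor
  · rintro ⟨⟨h1, h2⟩, h3, h4⟩
    exact ⟨⟨fun a => (h1 a).1, fun a => (h1 a).2, h2⟩, h3, fun b => (h4 b).1, fun b => (h4 b).2⟩
  · rintro ⟨⟨h1, h2, h3⟩, h4, h5, h6⟩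
    exact ⟨⟨fun a => ⟨h1 a, h2 a⟩, h3⟩, h4, fun b => ⟨h5 b, h6 b⟩⟩

theorem exists_fromBlocks_of_mem_incidenceStabilizer {A B : Type*} [Fintype A] [Fintype B]
    {R : A ⊕ B → A ⊕ B → Prop} (hBA : ∀ b a, ¬ R (.inr b) (.inl a)) {F x : Matrix (A ⊕ B) (A ⊕ B) ℂ}
    (hx : x ∈ incidenceStabilizer R F) : x = fromBlocks x.toBlocks₁₁ x.toBlocks₁₂ 0 x.toBlocks₂₂ := by
  conv_lhs => rw [← fromBlocks_toBlocks x]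
  congr 1
  ext b a
  exact hx.1 _ _ (hBA b a)

theorem finrank_incidenceStabilizer_conj_le_of_sq_eq_zero {ι : Type*} [Fintype ι] [DecidableEq ι]
    {R : ι → ι → Prop} (hR : ∀ i j k, R i j → R j k → R i k) (hR₀ : ∀ i, R i i)
    {F Y : Matrix ι ι ℂ} (hY : ∀ i j, ¬ R i j → Y i j = 0) (hYY : Y * Y = 0) :
    Module.finrank ℂ (incidenceStabilizer R ((1 + Y) * F * (1 - Y))) ≤
      Module.finrank ℂ (incidenceStabilizer R F) := by
  have h1 : ∀ i j, ¬ R i j → (1 : Matrix ι ι ℂ) i j = 0 := fun i j h =>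
    Matrix.one_apply_ne fun hij => h (hij ▸ hR₀ i)
  refine finrank_incidenceStabilizer_conj_le hR (fun i j h => ?_) (fun i j h => ?_) ?_
  · rw [Matrix.add_apply, h1 i j h, hY i j h, add_zero]
  · rw [Matrix.sub_apply, h1 i j h, hY i j h, sub_zero]
  · rw [mul_sub, mul_one, add_mul, one_mul, hYY, add_zero, add_sub_cancel_right]

/-- One round of Gaussian elimination with pivots in rows `q` and columns `p`: left multiplication
by `1 + Y` adds multiples of the rows `q` to the rows in `U`. The right factor `1 - Y` alters only
columns in the range of `q`, which the pivot columns avoid. As the rows `q` lie outside `U`, `Y * Y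
= 0`. -/
theorem exists_incidenceStabilizer_clear {ι : Type*} [Fintype ι] [DecidableEq ι]
    {R : ι → ι → Prop} (hR : ∀ i j k, R i j → R j k → R i k) (hR₀ : ∀ i, R i i) (F : Matrix ι ι ℂ)
    {p q : P → ι} (hq : Function.Injective q) (hF : ∀ a b, F (q a) (p b) = (1 : Matrix P P ℂ) a b)
    (hpq : ∀ b, p b ∉ Set.range q) (U : ι → Prop) (hUq : ∀ a, ¬ U (q a))
    (hU : ∀ i, U i → ∀ a, R i (q a)) :
    ∃ F' : Matrix ι ι ℂ, Module.finrank ℂ (incidenceStabilizer R F') ≤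
        Module.finrank ℂ (incidenceStabilizer R F) ∧
      (∀ i b, U i → F' i (p b) = 0) ∧ ∀ i j, ¬ U i → j ∉ Set.range q → F' i j = F i j := by
  classical
  let Z : Matrix ι P ℂ := Matrix.of fun i a => if U i then -F i (p a) else 0
  have hZ : (inclusionMatrix q)ᵀ * Z = 0 := by
    ext a b
    rw [transpose_inclusionMatrix_mul_apply]
    simp [Z, hUq]
  refine ⟨_, finrank_incidenceStabilizer_conj_le_of_sq_eq_zero (Y := Z * (inclusionMatrix q)ᵀ)
    hR hR₀ (fun i j hij => ?_) ?_, ?_⟩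
  · by_cases hj : j ∈ Set.range q
    · obtain ⟨a, rfl⟩ := hj
      rw [mul_transpose_inclusionMatrix_apply hq]
      have : ¬ U i := fun h => hij (hU i h a)
      simp [Z, this]
    · exact mul_transpose_inclusionMatrix_apply_of_notMem _ _ hj
  · rw [Matrix.mul_assoc, ← Matrix.mul_assoc _ Z, hZ, Matrix.zero_mul, Matrix.mul_zero]
  · have key : ∀ i j, j ∉ Set.range q → ((1 + Z * (inclusionMatrix q)ᵀ) * F *
        (1 - Z * (inclusionMatrix q)ᵀ) : Matrix ι ι ℂ) i j = F i j + (Z * ((inclusionMatrix q)ᵀ * F)) i j := by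
      intro i j hj
      rw [Matrix.mul_sub, Matrix.mul_one, Matrix.sub_apply, ← Matrix.mul_assoc,
        mul_transpose_inclusionMatrix_apply_of_notMem _ _ hj, sub_zero, Matrix.add_mul,
        Matrix.one_mul, Matrix.add_apply, Matrix.mul_assoc]
    refine ⟨fun i b hi => ?_, fun i j hi hj => ?_⟩
    · rw [key _ _ (hpq b), Matrix.mul_apply, Finset.sum_eq_single b]
      · simp [transpose_inclusionMatrix_mul_apply, hF, Z, hi]
      · intro a _ hab
        simp [transpose_inclusionMatrix_mul_apply, hF, hab]
      · simp
    · rw [key _ _ hj, Matrix.mul_apply]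
      simp [Z, hi]

section FreePart

variable {R : P ⊕ J → P ⊕ J → Prop} {R' : J → J → Prop} {up : J → Prop} {e : P → J} {n : ℕ}

/-- Write x with blocks u, v, 0, w and let E be the inclusion matrix. The equation vE = 0 kills v on
the range of `e`. The equation wE = Eu determines u from w and forces w to vanish from the rest of
`up` to the range of `e`; this is the relation dropped in `R'`. The last equation determines the
remaining entries of v exactly at the positions that `R'` no longer tests. Hence x is recovered from
w. -/
theorem finrank_incidenceStabilizer_fromBlocks_inclusionMatrix
    (he : Function.Injective e)
    (hPP : ∀ p p', R (.inl p) (.inl p')) (hJP : ∀ j p, ¬ R (.inr j) (.inl p))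
    (hPJ : ∀ p j, R (.inl p) (.inr j) ↔ up j) (hup : ∀ p, up (e p))
    (hU : ∀ j, up j → j ∉ Set.range e → ∀ p, R (.inr j) (.inr (e p)))
    (hR' : ∀ i j, R' i j ↔
      R (.inr i) (.inr j) ∧ ¬ (up i ∧ i ∉ Set.range e ∧ j ∈ Set.range e))
    (G : Matrix J J ℂ) :
    Module.finrank ℂ (incidenceStabilizer R (fromBlocks 0 0 (inclusionMatrix e) G)) =
      Module.finrank ℂ (incidenceStabilizer R' G) := by
  have hmem : ∀ (u : Matrix P P ℂ) v w, fromBlocks u v 0 w ∈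
      incidenceStabilizer R (fromBlocks 0 0 (inclusionMatrix e) G) ↔
      ((∀ p j, ¬ up j → v p j = 0) ∧ ∀ i j, ¬ R (.inr i) (.inr j) → w i j = 0) ∧
      (∀ p p', v p (e p') = 0) ∧
        (∀ j p, up j → w j (e p) - (inclusionMatrix e * u) j p = 0) ∧
        ∀ i j, R (.inr j) (.inr i) →
          (w * G) i j - ((inclusionMatrix e * v) i j + (G * w) i j) = 0 := by
    intro u v w
    rw [fromBlocks_mem_incidenceStabilizer hJP]
    simp [hPP, hPJ, mul_inclusionMatrix_apply]
  let T : incidenceStabilizer R (fromBlocks 0 0 (inclusionMatrix e) G) →ₗ[ℂ]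
      incidenceStabilizer R' G :=
    { toFun := fun x => ⟨x.1.toBlocks₂₂, by
        obtain ⟨x, hx⟩ := x
        rw [exists_fromBlocks_of_mem_incidenceStabilizer hJP hx, hmem] at hx
        obtain ⟨⟨hv, hw⟩, h1, h2, h3⟩ := hx
        refine ⟨fun i j hij => ?_, fun i j hji => ?_⟩
        · by_cases h : R (.inr i) (.inr j)
          · have : up i ∧ i ∉ Set.range e ∧ j ∈ Set.range e := by
              by_contra h'
              exact hij ((hR' i j).2 ⟨h, h'⟩)
            obtain ⟨hi, hie, p, rfl⟩ := this
            have := h2 i p hi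
            rwa [inclusionMatrix_mul_apply_of_notMem _ hie, sub_zero] at this
          · exact hw i j h
        · obtain ⟨hji, hne⟩ := (hR' j i).1 hji
          have := h3 i j hji
          have hz : (inclusionMatrix e * x.toBlocks₁₂) i j = 0 := by
            by_cases hi : i ∈ Set.range e
            · obtain ⟨p, rfl⟩ := hi
              rw [inclusionMatrix_mul_apply he]
              by_cases hj : j ∈ Set.range e
              · obtain ⟨p', rfl⟩ := hj
                exact h1 _ _
              · exact hv _ _ fun hj' => hne ⟨hj', hj, p, rfl⟩
            · exact inclusionMatrix_mul_apply_of_notMem _ hi j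
          rwa [hz, zero_add] at this⟩
      map_add' := fun x y => rfl
      map_smul' := fun c x => rfl }
  refine (LinearEquiv.ofBijective T ⟨?_, ?_⟩).finrank_eq
  · rw [← LinearMap.ker_eq_bot, LinearMap.ker_eq_bot']
    rintro ⟨x, hx⟩ h0
    have hw0 : x.toBlocks₂₂ = 0 := congrArg Subtype.val h0
    have hxe := exists_fromBlocks_of_mem_incidenceStabilizer hJP hx
    have hx' := hx
    rw [hxe, hmem, hw0] at hx'
    obtain ⟨⟨hv, hw⟩, h1, h2, h3⟩ := hx'
    have hu0 : x.toBlocks₁₁ = 0 := by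
      ext p p'
      have := h2 (e p) p' (hup p)
      rw [inclusionMatrix_mul_apply he, Matrix.zero_apply, zero_sub, neg_eq_zero] at this
      exact this
    have hv0 : x.toBlocks₁₂ = 0 := by
      ext p j
      by_cases hj : up j
      · by_cases hje : j ∈ Set.range e
        · obtain ⟨p', rfl⟩ := hje
          exact h1 _ _
        · have := h3 (e p) j (hU j hj hje p)
          rw [inclusionMatrix_mul_apply he, Matrix.zero_mul, Matrix.mul_zero, Matrix.zero_apply,
            add_zero, zero_sub, neg_eq_zero] at this
          exact this
      · exact hv p j hj
    ext1
    change x = 0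
    rw [hxe, hu0, hv0, hw0, fromBlocks_zero]
  · rintro ⟨w, hw, hw'⟩
    classical
    -- The values forced by the equations for u and v.
    let u : Matrix P P ℂ := Matrix.of fun p p' => w (e p) (e p')
    let v : Matrix P J ℂ := Matrix.of fun p j =>
      if up j ∧ j ∉ Set.range e then (w * G) (e p) j - (G * w) (e p) j else 0
    refine ⟨⟨fromBlocks u v 0 w, (hmem _ _ _).2 ⟨⟨?_, ?_⟩, ?_, ?_, ?_⟩⟩, rfl⟩
    · intro p j hj
      simp [v, hj]
    · intro i j hij
      exact hw i j fun h => hij ((hR' i j).1 h).1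
    · intro p p'
      simp [v]
    · intro j p hj
      by_cases hje : j ∈ Set.range e
      · obtain ⟨p', rfl⟩ := hje
        rw [inclusionMatrix_mul_apply he]
        simp [u]
      · rw [inclusionMatrix_mul_apply_of_notMem _ hje, sub_zero]
        exact hw _ _ fun h => ((hR' _ _).1 h).2 ⟨hj, hje, p, rfl⟩
    · intro i j hji
      by_cases hi : i ∈ Set.range e
      · obtain ⟨p, rfl⟩ := hi
        rw [inclusionMatrix_mul_apply he]
        by_cases hj : up j ∧ j ∉ Set.range e
        · simp only [v, Matrix.of_apply, if_pos hj]
          ring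
        · have := hw' (e p) j ((hR' _ _).2 ⟨hji, fun h => hj ⟨h.1, h.2.1⟩⟩)
          rw [Matrix.sub_apply] at this
          simp only [v, Matrix.of_apply, if_neg hj, zero_add]
          exact this
      · rw [inclusionMatrix_mul_apply_of_notMem _ hi, zero_add]
        exact hw' i j ((hR' _ _).2 ⟨hji, fun h => hi h.2.2⟩)

/-- The upper bound lifts a good form on `J` to the normal form. For the lower bound a generic form
is brought to the normal form by conjugation. -/
theorem HasIncidenceIndex.of_remove_class (hR : ∀ i j k, R i j → R j k → R i k) (hR₀ : ∀ i, R i i)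
    (he : Function.Injective e)
    (hPP : ∀ p p', R (.inl p) (.inl p')) (hJP : ∀ j p, ¬ R (.inr j) (.inl p))
    (hPJ : ∀ p j, R (.inl p) (.inr j) ↔ up j) (hup : ∀ p, up (e p))
    (hU : ∀ j, up j → j ∉ Set.range e → ∀ p, R (.inr j) (.inr (e p)))
    (hR' : ∀ i j, R' i j ↔
      R (.inr i) (.inr j) ∧ ¬ (up i ∧ i ∉ Set.range e ∧ j ∈ Set.range e))
    (h : HasIncidenceIndex R' n) : HasIncidenceIndex R n := by
  have hfin := finrank_incidenceStabilizer_fromBlocks_inclusionMatrix he hPP hJP hPJ hup hU hR'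
  obtain ⟨⟨G, hG⟩, h⟩ := h
  refine ⟨⟨_, (hfin G).trans_le hG⟩, ?_⟩
  -- With the identity as pivot minor, clearing the columns of `P` leaves only the normal form among
  -- the entries that matter.
  have step1 : ∀ F, (∀ p p', F (.inr (e p)) (.inl p') = (1 : Matrix P P ℂ) p p') →
      n ≤ Module.finrank ℂ (incidenceStabilizer R F) := by
    intro F hF
    obtain ⟨F', hle, hF'U, hF'⟩ := exists_incidenceStabilizer_clear hR hR₀ F
      (p := Sum.inl) (q := Sum.inr ∘ e) (Sum.inr_injective.comp he) hF (by simp)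
      (fun i => Sum.elim (fun _ => True) (fun j => up j ∧ j ∉ Set.range e) i)
      (by simp) (by
        rintro (p | j) hi a
        · exact (hPJ _ _).2 (hup a)
        · exact hU j hi.1 hi.2 a)
    refine le_trans ?_ hle
    rw [incidenceStabilizer_congr hR (F' := fromBlocks 0 0 (inclusionMatrix e) F'.toBlocks₂₂) ?_,
      hfin]
    · exact h _
    · rintro (i | i) (j | j) hji
      · exact hF'U (.inl i) j trivial
      · exact absurd hji (hJP _ _)
      · rw [hPJ] at hji
        rw [fromBlocks_apply₂₁]
        by_cases hi : i ∈ Set.range e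
        · obtain ⟨p, rfl⟩ := hi
          rw [hF' (.inr (e p)) (.inl j) (by simp) (by simp), hF]
          simp [inclusionMatrix, Matrix.one_apply, he.eq_iff]
        · have hi' : ∀ p, i ≠ e p := fun p hp => hi ⟨p, hp.symm⟩
          rw [hF'U (.inr i) j ⟨hji, hi⟩]
          simp [inclusionMatrix, hi']
      · rfl
  -- An invertible pivot minor becomes the identity under conjugation by diag(C, 1), since `P` is a
  -- full class.
  have step2 : ∀ F, IsUnit (Matrix.of fun p p' => F (.inr (e p)) (.inl p') : Matrix P P ℂ) →
      n ≤ Module.finrank ℂ (incidenceStabilizer R F) := by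
    intro F hF
    set C : Matrix P P ℂ := Matrix.of fun p p' => F (.inr (e p)) (.inl p') with hC
    have hCdet : IsUnit C.det := (Matrix.isUnit_iff_isUnit_det _).1 hF
    refine le_trans (step1 (fromBlocks C 0 0 1 * F * fromBlocks C⁻¹ 0 0 1) ?_)
      (finrank_incidenceStabilizer_conj_le hR ?_ ?_ ?_)
    · intro p p'
      rw [← Matrix.mul_nonsing_inv _ hCdet, ← fromBlocks_toBlocks F, fromBlocks_multiply,
        fromBlocks_multiply]
      simp [Matrix.mul_apply, hC, toBlocks₂₁]
    · rintro (i | i) (j | j) hij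
      · exact absurd (hPP _ _) hij
      · rfl
      · rfl
      · exact Matrix.one_apply_ne fun h => hij (h ▸ hR₀ _)
    · rintro (i | i) (j | j) hij
      · exact absurd (hPP _ _) hij
      · rfl
      · rfl
      · exact Matrix.one_apply_ne fun h => hij (h ▸ hR₀ _)
    · rw [fromBlocks_multiply]
      simp [Matrix.mul_nonsing_inv _ hCdet]
  intro F
  -- Moving in this direction replaces the pivot minor C by C + t, which is invertible for t
  -- arbitrarily close to 0.
  refine le_finrank_incidenceStabilizer_of_frequently
    (F₁ := fromBlocks 0 0 (inclusionMatrix e) 0) ?_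
  refine (frequently_isUnit_add_smul_one
    (Matrix.of fun p p' => F (.inr (e p)) (.inl p') : Matrix P P ℂ)).mono fun t ht => step2 _ ?_
  convert ht using 1
  ext p p'
  simp [inclusionMatrix, Matrix.one_apply, he.eq_iff]

end FreePart

end Reduction

/-! ### Elimination of a part of the first class. -/

section ReductionTwo

set_option linter.unusedSectionVars false

variable {P K M : Type*} [Fintype P] [Fintype K] [Fintype M]
  [DecidableEq P] [DecidableEq K] [DecidableEq M]

theorem eq_mul_transpose_inclusionMatrix {ι : Type*} {e : P → M} (he : Function.Injective e)
    {X : Matrix ι M ℂ} {Y : Matrix ι P ℂ} (hX : ∀ i m, m ∉ Set.range e → X i m = 0)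
    (hXY : X * inclusionMatrix e = Y) : X = Y * (inclusionMatrix e)ᵀ := by
  ext i m
  by_cases hm : m ∈ Set.range e
  · obtain ⟨p, rfl⟩ := hm
    rw [mul_transpose_inclusionMatrix_apply he, ← hXY, mul_inclusionMatrix_apply]
  · rw [hX i m hm, mul_transpose_inclusionMatrix_apply_of_notMem _ _ hm]

section PartialClass

variable {R : (P ⊕ K) ⊕ M → (P ⊕ K) ⊕ M → Prop} {R' : K ⊕ M → K ⊕ M → Prop} {e : P → M} {n : ℕ}

/-- Write x with upper left block (u, y; s, k), upper right block (v; t) and lower right block w.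
The equations give u = EᵀwE, y = 0, v = HsEᵀ and t = NsEᵀ, so x is determined by s, k and w. What
remains are the stabilizer equations on `K ⊕ M` for the matrix with blocks k, sEᵀ, 0, w; here s is
recovered from sEᵀ because EᵀE = 1. -/
theorem finrank_incidenceStabilizer_fromBlocks_fromCols (he : Function.Injective e)
    (hAA : ∀ a a', R (.inl a) (.inl a')) (hMA : ∀ m a, ¬ R (.inr m) (.inl a))
    (hAM : ∀ a m, R (.inl a) (.inr m) ↔ m ∈ Set.range e)
    (hKK : ∀ k k', R' (.inl k) (.inl k')) (hMK : ∀ m k, ¬ R' (.inr m) (.inl k))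
    (hKM : ∀ k m, R' (.inl k) (.inr m) ↔ m ∈ Set.range e)
    (hMM : ∀ m m', R' (.inr m) (.inr m') ↔ R (.inr m) (.inr m'))
    (H : Matrix P K ℂ) (N : Matrix K K ℂ) (G : Matrix M M ℂ) :
    Module.finrank ℂ (incidenceStabilizer R
      (fromBlocks (fromBlocks 0 H 0 N) 0 (fromCols (inclusionMatrix e) 0) G)) =
      Module.finrank ℂ (incidenceStabilizer R' (fromBlocks N 0 (inclusionMatrix e * H) G)) := by
  set E := inclusionMatrix e with hE
  have hEE : Eᵀ * E = 1 := transpose_inclusionMatrix_mul_self he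
  have hmem : ∀ (u : Matrix P P ℂ) (y : Matrix P K ℂ) s k v t w,
      fromBlocks (fromBlocks u y s k) (fromRows v t) 0 w ∈ incidenceStabilizer R
        (fromBlocks (fromBlocks 0 H 0 N) 0 (fromCols E 0) G) ↔
      (u = Eᵀ * w * E ∧ y = 0 ∧ v = H * s * Eᵀ ∧ t = N * s * Eᵀ) ∧
      (∀ i j, ¬ R (.inr i) (.inr j) → w i j = 0) ∧ Eᵀ * w * E * H = H * k ∧ s * H + k * N = N * k ∧
        ∀ i j, R (.inr j) (.inr i) → (w * G) i j - ((E * (H * s * Eᵀ)) i j + (G * w) i j) = 0 := by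
    intro u y s k v t w
    rw [fromBlocks_mem_incidenceStabilizer hMA, fromBlocks_multiply, fromBlocks_multiply,
      fromRows_mul_fromCols, mul_fromCols, fromCols_mul_fromBlocks, fromCols_mul_fromRows]
    simp only [Sum.forall, hAA, hAM, not_true_eq_false, false_imp_iff, implies_true, true_and,
      true_imp_iff, Matrix.mul_zero, Matrix.zero_mul, add_zero, zero_add, Matrix.zero_apply,
      fromBlocks_apply₁₁, fromBlocks_apply₁₂, fromBlocks_apply₂₁, fromBlocks_apply₂₂,
      fromRows_apply_inl, fromRows_apply_inr, fromCols_apply_inl, fromCols_apply_inr]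
    constructor
    · rintro ⟨⟨⟨hv, ht⟩, hw⟩, ⟨h1, h2⟩, h3, h4⟩
      have hu : u = Eᵀ * w * E := by
        ext p p'
        have := (h3 (e p)).1 p' ⟨p, rfl⟩
        rw [hE, inclusionMatrix_mul_apply he, sub_eq_zero] at this
        rw [← this, Matrix.mul_assoc, hE, transpose_inclusionMatrix_mul_apply]
      have hy : y = 0 := by
        ext p k
        have := (h3 (e p)).2 k ⟨p, rfl⟩
        rw [hE, inclusionMatrix_mul_apply he, zero_sub, neg_eq_zero] at this
        exact this
      have hv' : v = H * s * Eᵀ := eq_mul_transpose_inclusionMatrix he hv (by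
        ext p p'
        exact sub_eq_zero.1 ((h1 p).1 p'))
      have ht' : t = N * s * Eᵀ := eq_mul_transpose_inclusionMatrix he ht (by
        ext p p'
        exact sub_eq_zero.1 ((h2 p).1 p'))
      refine ⟨⟨hu, hy, hv', ht'⟩, hw, ?_, ?_, ?_⟩
      · ext p k
        have := (h1 p).2 k
        rw [hy, Matrix.zero_mul, add_zero, sub_eq_zero, hu] at this
        exact this
      · ext p k
        exact sub_eq_zero.1 ((h2 p).2 k)
      · rw [← hv']
        exact h4
    · rintro ⟨⟨hu, hy, hv, ht⟩, hw, h1, h2, h3⟩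
      have hvE : v * E = H * s := by rw [hv, Matrix.mul_assoc, hEE, Matrix.mul_one]
      have htE : t * E = N * s := by rw [ht, Matrix.mul_assoc, hEE, Matrix.mul_one]
      refine ⟨⟨⟨fun p m hm => ?_, fun k m hm => ?_⟩, hw⟩,
        ⟨fun p => ⟨fun p' => ?_, fun k => ?_⟩, fun p => ⟨fun p' => ?_, fun k => ?_⟩⟩, ?_, ?_⟩
      · rw [hv]
        exact mul_transpose_inclusionMatrix_apply_of_notMem _ _ hm
      · rw [ht]
        exact mul_transpose_inclusionMatrix_apply_of_notMem _ _ hm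
      · rw [hvE, sub_self]
      · rw [hy, Matrix.zero_mul, add_zero, hu, h1, sub_self]
      · rw [htE, sub_self]
      · rw [h2, sub_self]
      · rintro m
        refine ⟨fun p hm => ?_, fun k hm => ?_⟩
        · obtain ⟨p', rfl⟩ := hm
          rw [hE, inclusionMatrix_mul_apply he, ← hE, hu, Matrix.mul_assoc, hE,
            transpose_inclusionMatrix_mul_apply, sub_self]
        · rw [hy, Matrix.mul_zero, Matrix.zero_apply, sub_self]
      · rw [hv]
        exact h3
  have hmem' : ∀ (k : Matrix K K ℂ) r w,
      fromBlocks k r 0 w ∈ incidenceStabilizer R' (fromBlocks N 0 (E * H) G) ↔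
      (r = r * E * Eᵀ) ∧ (∀ i j, ¬ R (.inr i) (.inr j) → w i j = 0) ∧ Eᵀ * w * E * H = H * k ∧
        r * E * H + k * N = N * k ∧
        ∀ i j, R (.inr j) (.inr i) → (w * G) i j - ((E * (H * (r * E) * Eᵀ)) i j + (G * w) i j) = 0 := by
    intro k r w
    rw [fromBlocks_mem_incidenceStabilizer hMK]
    simp only [hKK, hKM, hMM, not_true_eq_false, false_imp_iff, implies_true, true_and,
      true_imp_iff]
    constructor
    · rintro ⟨⟨hr, hw⟩, h1, h2, h3⟩
      have hr' : r = r * E * Eᵀ := eq_mul_transpose_inclusionMatrix he hr rfl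
      refine ⟨hr', hw, ?_, ?_, ?_⟩
      · ext p k'
        have := h2 (e p) k' ⟨p, rfl⟩
        rw [Matrix.mul_assoc E, hE, inclusionMatrix_mul_apply he, sub_eq_zero] at this
        rw [← this, Matrix.mul_assoc, Matrix.mul_assoc, hE, transpose_inclusionMatrix_mul_apply]
      · ext k' k''
        have := sub_eq_zero.1 (h1 k' k'')
        rw [← this, add_comm, Matrix.mul_assoc, Matrix.add_apply]
      · intro i j hij
        have := h3 i j hij
        rw [Matrix.mul_assoc] at this
        rw [Matrix.mul_assoc H, ← hr']
        exact this
    · rintro ⟨hr, hw, h1, h2, h3⟩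
      refine ⟨⟨fun a m hm => ?_, hw⟩, fun k' k'' => ?_, fun m k' hm => ?_, fun i j hij => ?_⟩
      · rw [hr]
        exact mul_transpose_inclusionMatrix_apply_of_notMem _ _ hm
      · rw [← h2, Matrix.add_apply, Matrix.mul_assoc]
        ring
      · obtain ⟨p, rfl⟩ := hm
        rw [Matrix.mul_assoc E, hE, inclusionMatrix_mul_apply he, ← h1, Matrix.mul_assoc,
          Matrix.mul_assoc, hE, transpose_inclusionMatrix_mul_apply, sub_self]
      · have := h3 i j hij
        rw [Matrix.mul_assoc H, ← hr] at this
        rw [Matrix.mul_assoc]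
        exact this
  have hdecomp : ∀ x ∈ incidenceStabilizer R
      (fromBlocks (fromBlocks 0 H 0 N) 0 (fromCols E 0) G),
      x = fromBlocks (fromBlocks x.toBlocks₁₁.toBlocks₁₁ x.toBlocks₁₁.toBlocks₁₂
        x.toBlocks₁₁.toBlocks₂₁ x.toBlocks₁₁.toBlocks₂₂)
        (fromRows x.toBlocks₁₂.toRows₁ x.toBlocks₁₂.toRows₂) 0 x.toBlocks₂₂ := by
    intro x hx
    rw [fromBlocks_toBlocks, fromRows_toRows]
    exact exists_fromBlocks_of_mem_incidenceStabilizer hMA hx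
  let T : incidenceStabilizer R (fromBlocks (fromBlocks 0 H 0 N) 0 (fromCols E 0) G) →ₗ[ℂ]
      incidenceStabilizer R' (fromBlocks N 0 (E * H) G) :=
    { toFun := fun x => ⟨fromBlocks x.1.toBlocks₁₁.toBlocks₂₂ (x.1.toBlocks₁₁.toBlocks₂₁ * Eᵀ) 0
          x.1.toBlocks₂₂, by
        obtain ⟨x, hx⟩ := x
        rw [hdecomp x hx, hmem] at hx
        obtain ⟨-, hx⟩ := hx
        rw [hmem', Matrix.mul_assoc _ Eᵀ E, hEE, Matrix.mul_one]
        exact ⟨rfl, hx⟩⟩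
      map_add' := fun x y => by
        ext1
        change fromBlocks _ ((x.1.toBlocks₁₁.toBlocks₂₁ + y.1.toBlocks₁₁.toBlocks₂₁) * Eᵀ) _ _ = _
        rw [Matrix.add_mul]
        simp [fromBlocks_add]
        exact ⟨rfl, rfl⟩
      map_smul' := fun c x => by
        ext1
        change fromBlocks _ ((c • x.1.toBlocks₁₁.toBlocks₂₁) * Eᵀ) _ _ = _
        rw [Matrix.smul_mul]
        simp [fromBlocks_smul]
        exact ⟨rfl, rfl⟩ }
  refine (LinearEquiv.ofBijective T ⟨?_, ?_⟩).finrank_eq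
  · rw [← LinearMap.ker_eq_bot, LinearMap.ker_eq_bot']
    rintro ⟨x, hx⟩ h0
    have hxe := hdecomp x hx
    have h0' : fromBlocks x.toBlocks₁₁.toBlocks₂₂ (x.toBlocks₁₁.toBlocks₂₁ * Eᵀ) 0
        x.toBlocks₂₂ = fromBlocks 0 0 0 0 := by
      rw [fromBlocks_zero]
      exact congrArg Subtype.val h0
    obtain ⟨hk, hs, -, hw⟩ := fromBlocks_inj.1 h0'
    have hs' : x.toBlocks₁₁.toBlocks₂₁ = 0 := by
      rw [← Matrix.mul_one x.toBlocks₁₁.toBlocks₂₁, ← hEE, ← Matrix.mul_assoc, hs, Matrix.zero_mul]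
    rw [hxe, hmem] at hx
    obtain ⟨⟨hu, hy, hv, ht⟩, -⟩ := hx
    rw [hw] at hu
    rw [hs'] at hv ht
    ext1
    change x = 0
    rw [hxe, hu, hy, hv, ht, hk, hs', hw]
    simp
  · rintro ⟨x, hx⟩
    have hxe := exists_fromBlocks_of_mem_incidenceStabilizer hMK hx
    have hx' := hx
    rw [hxe, hmem'] at hx'
    refine ⟨⟨fromBlocks (fromBlocks (Eᵀ * x.toBlocks₂₂ * E) 0 (x.toBlocks₁₂ * E) x.toBlocks₁₁)
      (fromRows (H * (x.toBlocks₁₂ * E) * Eᵀ) (N * (x.toBlocks₁₂ * E) * Eᵀ)) 0 x.toBlocks₂₂,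
      (hmem _ _ _ _ _ _ _).2 ⟨⟨rfl, rfl, rfl, rfl⟩, hx'.2⟩⟩, ?_⟩
    ext1
    change fromBlocks x.toBlocks₁₁ (x.toBlocks₁₂ * E * Eᵀ) 0 x.toBlocks₂₂ = x
    rw [← hx'.1]
    exact hxe.symm

/-- Here only `P` is matched with the part of `M` lying above the class `P ⊕ K`. The pivot columns
can still be cleared, and `K` inherits the place of the class in the smaller algebra. -/
theorem HasIncidenceIndex.of_remove_subclass (hR : ∀ i j k, R i j → R j k → R i k)
    (hR₀ : ∀ i, R i i) (hR' : ∀ i j k, R' i j → R' j k → R' i k) (he : Function.Injective e)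
    (hAA : ∀ a a', R (.inl a) (.inl a')) (hMA : ∀ m a, ¬ R (.inr m) (.inl a))
    (hAM : ∀ a m, R (.inl a) (.inr m) ↔ m ∈ Set.range e)
    (hKK : ∀ k k', R' (.inl k) (.inl k')) (hMK : ∀ m k, ¬ R' (.inr m) (.inl k))
    (hKM : ∀ k m, R' (.inl k) (.inr m) ↔ m ∈ Set.range e)
    (hMM : ∀ m m', R' (.inr m) (.inr m') ↔ R (.inr m) (.inr m'))
    (h : HasIncidenceIndex R' n) : HasIncidenceIndex R n := by
  have hfin := finrank_incidenceStabilizer_fromBlocks_fromCols he hAA hMA hAM hKK hMK hKM hMM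
  obtain ⟨⟨F', hF'⟩, h⟩ := h
  refine ⟨⟨fromBlocks (fromBlocks 0 ((inclusionMatrix e)ᵀ * F'.toBlocks₂₁) 0 F'.toBlocks₁₁) 0
    (fromCols (inclusionMatrix e) 0) F'.toBlocks₂₂, ?_⟩, ?_⟩
  · refine (hfin _ _ _).trans_le (le_trans (le_of_eq ?_) hF')
    rw [incidenceStabilizer_congr hR' (F := F') (F' := fromBlocks F'.toBlocks₁₁ 0
      (inclusionMatrix e * ((inclusionMatrix e)ᵀ * F'.toBlocks₂₁)) F'.toBlocks₂₂)]
    rintro (i | i) (j | j) hji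
    · rfl
    · exact absurd hji (hMK _ _)
    · obtain ⟨p, rfl⟩ := (hKM _ _).1 hji
      rw [fromBlocks_apply₂₁, inclusionMatrix_mul_apply he, transpose_inclusionMatrix_mul_apply]
      rfl
    · rfl
  have step1 : ∀ F, (∀ p p', F (.inr (e p)) (.inl (.inl p')) = (1 : Matrix P P ℂ) p p') →
      (∀ p k, F (.inr (e p)) (.inl (.inr k)) = 0) →
      n ≤ Module.finrank ℂ (incidenceStabilizer R F) := by
    intro F hF hFK
    obtain ⟨F', hle, hF'U, hF'⟩ := exists_incidenceStabilizer_clear hR hR₀ F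
      (p := Sum.inl ∘ Sum.inl) (q := Sum.inr ∘ e) (Sum.inr_injective.comp he) hF (by simp)
      (fun i => Sum.elim (fun _ => True) (fun _ => False) i)
      (by simp) (by
        rintro (a | j) hi p
        · exact (hAM _ _).2 ⟨p, rfl⟩
        · exact hi.elim)
    refine le_trans ?_ hle
    rw [incidenceStabilizer_congr hR (F' := fromBlocks (fromBlocks 0 F'.toBlocks₁₁.toBlocks₁₂ 0
      F'.toBlocks₁₁.toBlocks₂₂) 0 (fromCols (inclusionMatrix e) 0) F'.toBlocks₂₂) ?_, hfin]
    · exact h _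
    · rintro (i | i) (j | j) hji
      · rcases i with i | i <;> rcases j with j | j
        · exact hF'U (.inl (.inl i)) j trivial
        · rfl
        · exact hF'U (.inl (.inr i)) j trivial
        · rfl
      · exact absurd hji (hMA _ _)
      · obtain ⟨p, rfl⟩ := (hAM _ _).1 hji
        rw [hF' (.inr (e p)) (.inl j) (by simp) (by simp)]
        rcases j with j | j
        · rw [hF]
          simp [inclusionMatrix, Matrix.one_apply, he.eq_iff]
        · rw [hFK]
          simp
      · rfl
  have step2 : ∀ F, IsUnit (Matrix.of fun p p' => F (.inr (e p)) (.inl (.inl p')) : Matrix P P ℂ) →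
      n ≤ Module.finrank ℂ (incidenceStabilizer R F) := by
    intro F hF
    set C : Matrix P P ℂ := Matrix.of fun p p' => F (.inr (e p)) (.inl (.inl p')) with hC
    set D : Matrix P K ℂ := Matrix.of fun p k => F (.inr (e p)) (.inl (.inr k)) with hD
    have hCdet : IsUnit C.det := (Matrix.isUnit_iff_isUnit_det _).1 hF
    -- The pivot rows restricted to `P ⊕ K` form the matrix (C, D); right multiplication by the
    -- inverse of (C, D; 0, 1) turns it into (1, 0).
    let g : Matrix ((P ⊕ K) ⊕ M) ((P ⊕ K) ⊕ M) ℂ := fromBlocks (fromBlocks C D 0 1) 0 0 1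
    let g' : Matrix ((P ⊕ K) ⊕ M) ((P ⊕ K) ⊕ M) ℂ :=
      fromBlocks (fromBlocks C⁻¹ (-(C⁻¹ * D)) 0 1) 0 0 1
    have hgF : ∀ p j, (g * F * g') (.inr (e p)) (.inl j) =
        (fromCols (C * C⁻¹) (-(C * (C⁻¹ * D)) + D)) p j := by
      intro p j
      have h2 : ∀ Z Z' : Matrix (P ⊕ K) (P ⊕ K) ℂ,
          (fromBlocks Z 0 0 1 * F * fromBlocks Z' 0 0 1 : Matrix ((P ⊕ K) ⊕ M) ((P ⊕ K) ⊕ M) ℂ)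
            (.inr (e p)) (.inl j) =
            (fromCols C D * Z') p j := by
        intro Z Z'
        conv_lhs => rw [← fromBlocks_toBlocks F]
        rw [fromBlocks_multiply, fromBlocks_multiply, fromBlocks_apply₂₁]
        simp [Matrix.mul_apply, hC, hD, toBlocks₂₁]
      rw [h2, fromCols_mul_fromBlocks]
      simp
    have hsupp : ∀ Z : Matrix (P ⊕ K) (P ⊕ K) ℂ, ∀ i j, ¬ R i j →
        (fromBlocks Z 0 0 (1 : Matrix M M ℂ)) i j = 0 := by
      rintro Z (i | i) (j | j) hij
      · exact absurd (hAA _ _) hij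
      · rfl
      · rfl
      · exact Matrix.one_apply_ne fun h => hij (h ▸ hR₀ _)
    refine le_trans (step1 (g * F * g') ?_ ?_)
      (finrank_incidenceStabilizer_conj_le hR (hsupp _) (hsupp _) ?_)
    · intro p p'
      rw [hgF, Matrix.mul_nonsing_inv _ hCdet, fromCols_apply_inl]
    · intro p k
      rw [hgF, ← Matrix.mul_assoc, Matrix.mul_nonsing_inv _ hCdet, fromCols_apply_inr]
      simp
    · rw [fromBlocks_multiply, fromBlocks_multiply]
      simp [← Matrix.mul_assoc, Matrix.mul_nonsing_inv _ hCdet]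
  intro F
  refine le_finrank_incidenceStabilizer_of_frequently
    (F₁ := fromBlocks 0 0 (fromCols (inclusionMatrix e) 0) 0) ?_
  refine (frequently_isUnit_add_smul_one
    (Matrix.of fun p p' => F (.inr (e p)) (.inl (.inl p')) : Matrix P P ℂ)).mono
      fun t ht => step2 _ ?_
  convert ht using 1
  ext p p'
  simp [inclusionMatrix, Matrix.one_apply, he.eq_iff]

end PartialClass

end ReductionTwo

/-! ### The index of gl(d) and of direct sums. -/

section FullBlock

/-- A relation between the powers of `N`, applied to the cyclic vector `v`, becomes a relation
between the columns of this matrix. -/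
theorem linearIndependent_pow_of_det_ne_zero {d : ℕ} {N : Matrix (Fin d) (Fin d) ℂ}
    {v : Fin d → ℂ}
    (h : (Matrix.of fun i j : Fin d => (N ^ (j : ℕ) *ᵥ v) i).det ≠ 0) :
    LinearIndependent ℂ fun j : Fin d => N ^ (j : ℕ) := by
  rw [Fintype.linearIndependent_iff]
  intro c hc
  have h0 : (Matrix.of fun i j : Fin d => (N ^ (j : ℕ) *ᵥ v) i) *ᵥ c = 0 := by
    have h1 := congrArg (fun Z : Matrix (Fin d) (Fin d) ℂ => Z *ᵥ v) hc
    simp only [Matrix.sum_mulVec, Matrix.zero_mulVec, Matrix.smul_mulVec] at h1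
    rw [← h1]
    ext i
    simp [Matrix.mulVec, dotProduct, mul_comm]
  exact fun i => congrFun (Matrix.eq_zero_of_mulVec_eq_zero h h0) i

/-- A generic matrix has a cyclic vector, so its centralizer contains d independent powers.
Cyclicity of the all-ones vector is tested on the line from `F` to diag(0, …, d - 1), where it is
polynomial in t; at t = 1 the determinant is a Vandermonde determinant. -/
theorem le_finrank_incidenceStabilizer_true {d : ℕ} (F : Matrix (Fin d) (Fin d) ℂ) :
    d ≤ Module.finrank ℂ (incidenceStabilizer (fun _ _ => True) F) := by
  let D : Matrix (Fin d) (Fin d) ℂ := Matrix.diagonal fun i => ((i : ℕ) : ℂ)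
  let Np : Matrix (Fin d) (Fin d) (Polynomial ℂ) :=
    F.map Polynomial.C + (Polynomial.X : Polynomial ℂ) • (D - F).map Polynomial.C
  let Wp : Matrix (Fin d) (Fin d) (Polynomial ℂ) := Matrix.of fun i j => (Np ^ (j : ℕ) *ᵥ 1) i
  have heval : ∀ t : ℂ, (Wp.det).eval t =
      (Matrix.of fun i j : Fin d => ((F + t • (D - F)) ^ (j : ℕ) *ᵥ 1) i).det := by
    intro t
    rw [← Polynomial.coe_evalRingHom, RingHom.map_det]
    congr 1
    ext i j
    have hN : (Polynomial.evalRingHom t).mapMatrix Np = F + t • (D - F) := by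
      ext i j
      simp [Np]
    change Polynomial.evalRingHom t ((Np ^ (j : ℕ) *ᵥ 1) i) = _
    rw [RingHom.map_mulVec, ← RingHom.mapMatrix_apply, map_pow, hN, Matrix.of_apply]
    have h1 : (Polynomial.evalRingHom t) ∘ (1 : Fin d → Polynomial ℂ) = 1 := by
      ext i
      simp
    rw [h1]
  have hne : Wp.det ≠ 0 := by
    intro h0
    have h1 := heval 1
    rw [h0, Polynomial.eval_zero, one_smul, add_sub_cancel] at h1
    have h2 : (Matrix.of fun i j : Fin d => (D ^ (j : ℕ) *ᵥ 1) i) =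
        Matrix.vandermonde fun i : Fin d => ((i : ℕ) : ℂ) := by
      ext i j
      simp [D, Matrix.diagonal_pow, Matrix.mulVec_diagonal, Matrix.vandermonde]
    rw [h2] at h1
    refine (Matrix.det_vandermonde_ne_zero_iff.2 ?_) h1.symm
    intro i j hij
    exact Fin.ext (Nat.cast_injective hij)
  refine le_finrank_incidenceStabilizer_of_frequently (F₁ := D - F) ?_
  refine (frequently_nhds_zero_eval_ne_zero hne).mono fun t ht => ?_
  rw [heval] at ht
  have hli := linearIndependent_pow_of_det_ne_zero ht
  have hmem : ∀ j : Fin d, (F + t • (D - F)) ^ (j : ℕ) ∈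
      incidenceStabilizer (fun _ _ : Fin d => True) (F + t • (D - F)) := by
    intro j
    refine ⟨fun _ _ h => absurd trivial h, fun i k _ => ?_⟩
    rw [← pow_succ, ← pow_succ', sub_self, Matrix.zero_apply]
  have hli' : LinearIndependent ℂ fun j : Fin d =>
      (⟨_, hmem j⟩ : incidenceStabilizer (fun _ _ : Fin d => True) (F + t • (D - F))) :=
    LinearIndependent.of_comp (Submodule.subtype _) hli
  simpa using hli'.fintype_card_le_finrank

/-- The upper bound comes from a diagonal matrix with distinct entries, whose centralizer is
diagonal. -/
theorem hasIncidenceIndex_true (d : ℕ) : HasIncidenceIndex (fun _ _ : Fin d => True) d := by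
  refine ⟨⟨Matrix.diagonal fun i => ((i : ℕ) : ℂ), ?_⟩, le_finrank_incidenceStabilizer_true⟩
  let T := (Matrix.diagLinearMap (Fin d) ℂ ℂ) ∘ₗ (incidenceStabilizer (fun _ _ : Fin d => True)
    (Matrix.diagonal fun i => ((i : ℕ) : ℂ))).subtype
  have hT : Function.Injective T := by
    rw [← LinearMap.ker_eq_bot, LinearMap.ker_eq_bot']
    rintro ⟨x, hx₀, hx⟩ h0
    refine Subtype.ext (Matrix.ext fun i j => ?_)
    by_cases hij : i = j
    · subst hij
      exact congrFun h0 i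
    · have := hx i j trivial
      rw [Matrix.sub_apply, Matrix.mul_diagonal, Matrix.diagonal_mul, mul_comm, ← sub_mul] at this
      refine (mul_eq_zero.1 this).resolve_left ?_
      exact fun h => hij (Fin.ext (Nat.cast_injective (sub_eq_zero.1 h)).symm)
  simpa using LinearMap.finrank_le_finrank_of_injective hT

variable {P J : Type*} [Fintype P] [Fintype J]

theorem finrank_incidenceStabilizer_sum {R : P ⊕ J → P ⊕ J → Prop}
    (hJP : ∀ j p, ¬ R (.inr j) (.inl p)) (hPJ : ∀ p j, ¬ R (.inl p) (.inr j))
    (Φ : Matrix P P ℂ) (G : Matrix J J ℂ) :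
    Module.finrank ℂ (incidenceStabilizer R (fromBlocks Φ 0 0 G)) =
      Module.finrank ℂ (incidenceStabilizer (fun p p' => R (.inl p) (.inl p')) Φ) +
        Module.finrank ℂ (incidenceStabilizer (fun j j' => R (.inr j) (.inr j')) G) := by
  rw [← Module.finrank_prod]
  have hmem : ∀ u w, fromBlocks u 0 0 w ∈ incidenceStabilizer R (fromBlocks Φ 0 0 G) ↔
      u ∈ incidenceStabilizer (fun p p' => R (.inl p) (.inl p')) Φ ∧
      w ∈ incidenceStabilizer (fun j j' => R (.inr j) (.inr j')) G := by
    intro u w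
    rw [fromBlocks_mem_incidenceStabilizer hJP, mem_incidenceStabilizer, mem_incidenceStabilizer]
    simp [hPJ]
    tauto
  have hdecomp : ∀ x ∈ incidenceStabilizer R (fromBlocks Φ 0 0 G),
      x = fromBlocks x.toBlocks₁₁ 0 0 x.toBlocks₂₂ := by
    intro x hx
    conv_lhs => rw [exists_fromBlocks_of_mem_incidenceStabilizer hJP hx]
    congr 1
    ext p j
    exact hx.1 _ _ (hPJ p j)
  let T : incidenceStabilizer R (fromBlocks Φ 0 0 G) →ₗ[ℂ]
      incidenceStabilizer (fun p p' => R (.inl p) (.inl p')) Φ ×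
      incidenceStabilizer (fun j j' => R (.inr j) (.inr j')) G :=
    { toFun := fun x =>
        (⟨x.1.toBlocks₁₁, ((hmem _ _).1 (hdecomp x.1 x.2 ▸ x.2)).1⟩,
          ⟨x.1.toBlocks₂₂, ((hmem _ _).1 (hdecomp x.1 x.2 ▸ x.2)).2⟩)
      map_add' := fun _ _ => rfl
      map_smul' := fun _ _ => rfl }
  refine (LinearEquiv.ofBijective T ⟨?_, ?_⟩).finrank_eq
  · rintro ⟨x, hx⟩ ⟨y, hy⟩ h
    have h1 : x.toBlocks₁₁ = y.toBlocks₁₁ := congrArg (fun z => z.1.1) h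
    have h2 : x.toBlocks₂₂ = y.toBlocks₂₂ := congrArg (fun z => z.2.1) h
    ext1
    change x = y
    rw [hdecomp x hx, hdecomp y hy, h1, h2]
  · rintro ⟨⟨u, hu⟩, ⟨w, hw⟩⟩
    exact ⟨⟨_, (hmem u w).2 ⟨hu, hw⟩⟩, rfl⟩

theorem HasIncidenceIndex.sum {R : P ⊕ J → P ⊕ J → Prop} {m n : ℕ}
    (hR : ∀ i j k, R i j → R j k → R i k)
    (hJP : ∀ j p, ¬ R (.inr j) (.inl p)) (hPJ : ∀ p j, ¬ R (.inl p) (.inr j))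
    (hP : HasIncidenceIndex (fun p p' => R (.inl p) (.inl p')) m)
    (hJ : HasIncidenceIndex (fun j j' => R (.inr j) (.inr j')) n) :
    HasIncidenceIndex R (m + n) := by
  obtain ⟨⟨Φ, hΦ⟩, hP⟩ := hP
  obtain ⟨⟨G, hG⟩, hJ⟩ := hJ
  refine ⟨⟨fromBlocks Φ 0 0 G, ?_⟩, fun F => ?_⟩
  · rw [finrank_incidenceStabilizer_sum hJP hPJ]
    exact add_le_add hΦ hG
  · rw [incidenceStabilizer_congr hR (F' := fromBlocks F.toBlocks₁₁ 0 0 F.toBlocks₂₂),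
      finrank_incidenceStabilizer_sum hJP hPJ]
    · exact add_le_add (hP _) (hJ _)
    · rintro (i | i) (j | j) hji
      · rfl
      · exact absurd hji (hJP _ _)
      · exact absurd hji (hPJ _ _)
      · rfl

theorem hasIncidenceIndex_card {R : P → P → Prop} (hR : ∀ i j, R i j) :
    HasIncidenceIndex R (Fintype.card P) :=
  (hasIncidenceIndex_true _).reindex (Fintype.equivFin P) (by simp [hR])

end FullBlock

/-! ### Seaweed algebras and the invariants of their permutations. -/

section Seaweed

/-- A decomposition of the integer interval `[s, N)` into consecutive blocks, encoded by the
function `c` with `c i = l + r` for `i` in the block `[l, r]`; thus `i ↦ c i - i` reverses each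
block. -/
structure IsBlockSum (s N : ℤ) (c : ℤ → ℤ) : Prop where
  mono : ∀ i j, s ≤ i → i ≤ j → j < N → c i ≤ c j
  lo : ∀ i, s ≤ i → i < N → s ≤ c i - i
  hi : ∀ i, s ≤ i → i < N → c i - i < N
  inv : ∀ i, s ≤ i → i < N → c (c i - i) = c i

/-- The positions of the nonzero entries in a seaweed algebra: upper triangular positions inside
the blocks of `cT` and lower triangular positions inside the blocks of `cS`. -/
def seaweedRel (cS cT : ℤ → ℤ) (i j : ℤ) : Prop :=
  (i ≤ j ∧ cT i = cT j) ∨ (j ≤ i ∧ cS i = cS j)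

/-- The composition of the block reversals for `cS` and `cT`. -/
def seaweedPerm (cS cT : ℤ → ℤ) (i : ℤ) : ℤ := cT (cS i - i) - (cS i - i)

/-- The functions on `[s, N)` which are constant on the cycles of `seaweedPerm cS cT`. -/
def seaweedInvariants (s N : ℤ) (cS cT : ℤ → ℤ) : Submodule ℂ (ℤ → ℂ) where
  carrier := {φ | (∀ i, ¬ (s ≤ i ∧ i < N) → φ i = 0) ∧
    ∀ i, s ≤ i → i < N → φ (seaweedPerm cS cT i) = φ i}
  zero_mem' := by simp
  add_mem' := by
    rintro φ ψ ⟨h1, h2⟩ ⟨h3, h4⟩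
    exact ⟨fun i hi => by simp [h1 i hi, h3 i hi],
      fun i hi hi' => by simp [h2 i hi hi', h4 i hi hi']⟩
  smul_mem' := by
    rintro c φ ⟨h1, h2⟩
    exact ⟨fun i hi => by simp [h1 i hi], fun i hi hi' => by simp [h2 i hi hi']⟩

instance (s N : ℤ) (cS cT : ℤ → ℤ) : Module.Finite ℂ (seaweedInvariants s N cS cT) := by
  let T : seaweedInvariants s N cS cT →ₗ[ℂ] (Set.Ico s N → ℂ) :=
    (LinearMap.funLeft ℂ ℂ (Subtype.val : Set.Ico s N → ℤ)) ∘ₗ Submodule.subtype _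
  refine Module.Finite.of_injective T ?_
  rintro ⟨φ, hφ, _⟩ ⟨ψ, hψ, _⟩ h
  ext i
  by_cases hi : s ≤ i ∧ i < N
  · exact congrFun h ⟨i, hi⟩
  · exact (hφ i hi).trans (hψ i hi).symm

variable {s s' N : ℤ} {c cS cT cS' cT' : ℤ → ℤ}

theorem IsBlockSum.eq_of_le (h : IsBlockSum s N c) (hs : s < N) {i : ℤ} (hi : s ≤ i)
    (hi' : i ≤ c s - s) : c i = c s := by
  have h1 := h.hi s le_rfl hs
  have h2 := h.inv s le_rfl hs
  have h3 := h.mono s i le_rfl hi (by omega)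
  have h4 := h.mono i (c s - s) hi hi' h1
  omega

/-- Equality of the values would put `i` inside the first block, because the reflection of `i` is at
least `s`. Likewise a reflection landing in the first block would have the value `c s`, contrary to
`inv`. -/
theorem IsBlockSum.lt_of_lt (h : IsBlockSum s N c) (hs : s < N) {i : ℤ} (hi : c s - s < i)
    (hi' : i < N) : c s < c i ∧ c s - s < c i - i := by
  have h0 := h.lo s le_rfl hs
  have h1 := h.mono s i le_rfl (by omega) hi'
  have h2 := h.lo i (by omega) hi'
  have h3 := h.inv i (by omega) hi'
  have h4 : c s < c i := by omega
  refine ⟨h4, ?_⟩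
  by_contra h5
  have := h.eq_of_le hs h2 (by omega)
  omega

theorem IsBlockSum.tail (h : IsBlockSum s N c) (hs : s < N) :
    IsBlockSum (c s - s + 1) N c := by
  have h0 := h.lo s le_rfl hs
  refine ⟨fun i j hi hij hj => h.mono i j (by omega) hij hj, fun i hi hi' => ?_,
    fun i hi hi' => h.hi i (by omega) hi', fun i hi hi' => h.inv i (by omega) hi'⟩
  have := h.lt_of_lt hs (i := i) (by omega) hi'
  omega

theorem seaweedRel_refl (i : ℤ) : seaweedRel cS cT i i := Or.inl ⟨le_rfl, rfl⟩

/-- For two steps in opposite directions, one endpoint lies between the other endpoint and the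
middle point; monotonicity of the block function puts it in the same block. -/
theorem seaweedRel_trans (hS : IsBlockSum s N cS) (hT : IsBlockSum s N cT) {i j k : ℤ}
    (hi : i ∈ Set.Ico s N) (hj : j ∈ Set.Ico s N) (hk : k ∈ Set.Ico s N)
    (hij : seaweedRel cS cT i j) (hjk : seaweedRel cS cT j k) : seaweedRel cS cT i k := by
  obtain ⟨hi, hi'⟩ := hi
  obtain ⟨hj, hj'⟩ := hj
  obtain ⟨hk, hk'⟩ := hk
  rcases hij with ⟨h1, h2⟩ | ⟨h1, h2⟩ <;> rcases hjk with ⟨h3, h4⟩ | ⟨h3, h4⟩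
  · exact Or.inl ⟨h1.trans h3, h2.trans h4⟩
  · rcases le_total i k with h | h
    · have := hT.mono i k hi h hk'
      have := hT.mono k j hk h3 hj'
      exact Or.inl ⟨h, by omega⟩
    · have := hS.mono k i hk h hi'
      have := hS.mono i j hi h1 hj'
      exact Or.inr ⟨h, by omega⟩
  · rcases le_total i k with h | h
    · have := hT.mono i k hi h hk'
      have := hT.mono j i hj h1 hi'
      exact Or.inl ⟨h, by omega⟩
    · have := hS.mono k i hk h hi'
      have := hS.mono j k hj h3 hk'
      exact Or.inr ⟨h, by omega⟩
  · exact Or.inr ⟨h3.trans h1, h2.trans h4⟩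

/-- An interval as the disjoint union of two consecutive intervals. -/
def icoSumEquiv {s t N : ℤ} (hst : s ≤ t) (htN : t ≤ N) :
    Set.Ico s N ≃ Set.Ico s t ⊕ Set.Ico t N where
  toFun i := if h : (i : ℤ) < t then .inl ⟨i, i.2.1, h⟩ else .inr ⟨i, not_lt.1 h, i.2.2⟩
  invFun := Sum.elim (fun i => ⟨i, i.2.1, i.2.2.trans_le htN⟩) fun i => ⟨i, hst.trans i.2.1, i.2.2⟩
  left_inv i := by
    by_cases h : (i : ℤ) < t <;> simp [h]
  right_inv i := by
    rcases i with ⟨i, hi⟩ | ⟨i, hi⟩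
    · simp [hi.2]
    · simp [not_lt.2 hi.1]

theorem sumElim_icoSumEquiv {s t N : ℤ} (hst : s ≤ t) (htN : t ≤ N) (i : Set.Ico s N) :
    Sum.elim (fun j : Set.Ico s t => (j : ℤ)) (fun j : Set.Ico t N => (j : ℤ))
      (icoSumEquiv hst htN i) = i := by
  by_cases h : (i : ℤ) < t <;> simp [icoSumEquiv, h]

/-- The second permutation is the first return map of the first one to `[s', N)`, every removed
point re-entering after one step. An invariant function is determined by its restriction, and
extends back by its value at the next point of the orbit. -/
theorem finrank_seaweedInvariants_of_return (hs : s ≤ s')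
    (h₁ : ∀ i, s ≤ i → i < s' → s' ≤ seaweedPerm cS cT i)
    (h₂ : ∀ i, s ≤ i → i < N → s ≤ seaweedPerm cS cT i ∧ seaweedPerm cS cT i < N)
    (h₃ : ∀ i, s' ≤ i → i < N → s' ≤ seaweedPerm cS cT i →
      seaweedPerm cS' cT' i = seaweedPerm cS cT i)
    (h₄ : ∀ i, s' ≤ i → i < N → seaweedPerm cS cT i < s' →
      seaweedPerm cS' cT' i = seaweedPerm cS cT (seaweedPerm cS cT i)) (hs' : s' ≤ N) :
    Module.finrank ℂ (seaweedInvariants s' N cS' cT') =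
      Module.finrank ℂ (seaweedInvariants s N cS cT) := by
  let T : seaweedInvariants s N cS cT →ₗ[ℂ] seaweedInvariants s' N cS' cT' :=
    { toFun := fun φ => ⟨fun i => if s' ≤ i then φ.1 i else 0, by
        obtain ⟨φ, hφ, hφ'⟩ := φ
        refine ⟨fun i hi => ?_, fun i hi hi' => ?_⟩
        · dsimp only
          split_ifs with h
          · exact hφ i (by omega)
          · rfl
        · dsimp only
          have hb := h₂ i (by omega) hi'
          rw [if_pos hi]
          by_cases h : s' ≤ seaweedPerm cS cT i
          · rw [h₃ i hi hi' h, if_pos h]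
            exact hφ' i (by omega) hi'
          · rw [h₄ i hi hi' (by omega), if_pos (h₁ _ hb.1 (by omega)), hφ' _ hb.1 hb.2]
            exact hφ' i (by omega) hi'⟩
      map_add' := fun φ ψ => by
        ext i
        by_cases h : s' ≤ i <;> simp [h]
      map_smul' := fun c φ => by
        ext i
        by_cases h : s' ≤ i <;> simp [h] }
  refine (LinearEquiv.ofBijective T ⟨?_, ?_⟩).finrank_eq.symm
  · rw [← LinearMap.ker_eq_bot, LinearMap.ker_eq_bot']
    rintro ⟨φ, hφ, hφ'⟩ h0
    have h0' : ∀ i, s' ≤ i → φ i = 0 := by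
      intro i hi
      have : (if s' ≤ i then φ i else 0) = 0 := congrFun (congrArg Subtype.val h0) i
      rwa [if_pos hi] at this
    ext i
    change φ i = 0
    by_cases hi : s' ≤ i
    · exact h0' i hi
    · by_cases hi' : s ≤ i
      · rw [← hφ' i hi' (by omega)]
        exact h0' _ (h₁ i hi' (by omega))
      · exact hφ i (by omega)
  · rintro ⟨ψ, hψ, hψ'⟩
    have hval : ∀ i, s' ≤ i → (if s ≤ i ∧ i < s' then ψ (seaweedPerm cS cT i) else ψ i) = ψ i :=
      fun i hi => if_neg (by omega)
    refine ⟨⟨fun i => if s ≤ i ∧ i < s' then ψ (seaweedPerm cS cT i) else ψ i, fun i hi => ?_,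
      fun i hi hi' => ?_⟩, ?_⟩
    · dsimp only
      rw [if_neg (by omega)]
      exact hψ i (by omega)
    · dsimp only
      have hb := h₂ i hi hi'
      by_cases h : i < s'
      · rw [hval _ (h₁ i hi h), if_pos ⟨hi, h⟩]
      · rw [hval i (by omega)]
        by_cases h' : s' ≤ seaweedPerm cS cT i
        · rw [hval _ h', ← h₃ i (by omega) hi' h']
          exact hψ' i (by omega) hi'
        · rw [if_pos ⟨hb.1, by omega⟩, ← h₄ i (by omega) hi' (by omega)]
          exact hψ' i (by omega) hi'
    · ext i
      change (if s' ≤ i then (if s ≤ i ∧ i < s' then ψ (seaweedPerm cS cT i) else ψ i) else 0) = ψ i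
      by_cases hi : s' ≤ i
      · rw [if_pos hi, hval i hi]
      · rw [if_neg hi, hψ i (by omega)]

theorem finrank_seaweedInvariants_of_fixed (hs : s ≤ s') (hs' : s' ≤ N)
    (h₁ : ∀ i, s ≤ i → i < s' → seaweedPerm cS cT i = i)
    (h₂ : ∀ i, s' ≤ i → i < N → s' ≤ seaweedPerm cS cT i) :
    Fintype.card (Set.Ico s s') + Module.finrank ℂ (seaweedInvariants s' N cS cT) =
      Module.finrank ℂ (seaweedInvariants s N cS cT) := by
  rw [← Module.finrank_fintype_fun_eq_card ℂ, ← Module.finrank_prod]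
  let T : seaweedInvariants s N cS cT →ₗ[ℂ] (Set.Ico s s' → ℂ) × seaweedInvariants s' N cS cT :=
    { toFun := fun φ => (fun i => φ.1 i, ⟨fun i => if s' ≤ i then φ.1 i else 0, by
        obtain ⟨φ, hφ, hφ'⟩ := φ
        refine ⟨fun i hi => ?_, fun i hi hi' => ?_⟩
        · dsimp only
          split_ifs with h
          · exact hφ i (by omega)
          · rfl
        · dsimp only
          rw [if_pos hi, if_pos (h₂ i hi hi')]
          exact hφ' i (by omega) hi'⟩)
      map_add' := fun φ ψ => by
        ext i
        · rfl
        · by_cases h : s' ≤ i <;> simp [h]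
      map_smul' := fun c φ => by
        ext i
        · rfl
        · by_cases h : s' ≤ i <;> simp [h] }
  refine (LinearEquiv.ofBijective T ⟨?_, ?_⟩).finrank_eq.symm
  · rw [← LinearMap.ker_eq_bot, LinearMap.ker_eq_bot']
    rintro ⟨φ, hφ, hφ'⟩ h0
    ext i
    change φ i = 0
    by_cases hi : s' ≤ i
    · have : (if s' ≤ i then φ i else 0) = 0 := congrFun (congrArg (fun z => z.2.1) h0) i
      rwa [if_pos hi] at this
    · by_cases hi' : s ≤ i
      · exact congrFun (congrArg (fun z => z.1) h0) ⟨i, hi', by omega⟩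
      · exact hφ i (by omega)
  · rintro ⟨f, ψ, hψ, hψ'⟩
    have hval : ∀ i, s' ≤ i → (if h : s ≤ i ∧ i < s' then f ⟨i, h⟩ else ψ i) = ψ i :=
      fun i hi => dif_neg (by omega)
    refine ⟨⟨fun i => if h : s ≤ i ∧ i < s' then f ⟨i, h⟩ else ψ i, fun i hi => ?_,
      fun i hi hi' => ?_⟩, ?_⟩
    · dsimp only
      rw [dif_neg (by omega)]
      exact hψ i (by omega)
    · dsimp only
      by_cases h : i < s'
      · rw [h₁ i hi h]
      · rw [hval i (by omega), hval _ (h₂ i (by omega) hi')]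
        exact hψ' i (by omega) hi'
    · ext i
      · exact dif_pos i.2
      · change (if s' ≤ i then (if h : s ≤ i ∧ i < s' then f ⟨i, h⟩ else ψ i) else 0) = ψ i
        by_cases hi : s' ≤ i
        · rw [if_pos hi, hval i hi]
        · rw [if_neg hi, hψ i (by omega)]

/-- Composing the two involutions in the other order gives the inverse permutation. -/
theorem seaweedInvariants_swap (hS : IsBlockSum s N cS) (hT : IsBlockSum s N cT) :
    seaweedInvariants s N cS cT = seaweedInvariants s N cT cS := by
  have key : ∀ {cS cT : ℤ → ℤ}, IsBlockSum s N cS → IsBlockSum s N cT →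
      seaweedInvariants s N cS cT ≤ seaweedInvariants s N cT cS := by
    rintro cS cT hS hT φ ⟨h1, h2⟩
    refine ⟨h1, fun i hi hi' => ?_⟩
    have hlo := hT.lo i hi hi'
    have hhi := hT.hi i hi hi'
    have h3 := h2 (seaweedPerm cT cS i) (hS.lo _ hlo hhi) (hS.hi _ hlo hhi)
    have h4 : seaweedPerm cS cT (seaweedPerm cT cS i) = i := by
      simp only [seaweedPerm]
      rw [hS.inv _ hlo hhi, sub_sub_cancel, hT.inv _ hi hi', sub_sub_cancel]
    rw [h4] at h3
    exact h3.symm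
  exact le_antisymm (key hS hT) (key hT hS)

end Seaweed

/-! ### The index of a seaweed algebra by induction on the first blocks. -/

section SeaweedInduction

variable {s s' N : ℤ} {c cS cT cS' cT' : ℤ → ℤ}

theorem hasIncidenceIndex_icoSum {s t N : ℤ} (hst : s ≤ t) (htN : t ≤ N) (r : ℤ → ℤ → Prop)
    {n : ℕ} : HasIncidenceIndex (fun i j : Set.Ico s N => r i j) n ↔
      HasIncidenceIndex (fun x y : Set.Ico s t ⊕ Set.Ico t N =>
        r (Sum.elim Subtype.val Subtype.val x) (Sum.elim Subtype.val Subtype.val y)) n := by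
  have key := sumElim_icoSumEquiv hst htN
  constructor
  · intro h
    refine h.reindex (icoSumEquiv hst htN).symm fun i j => ?_
    rw [← key, ← key, Equiv.apply_symm_apply, Equiv.apply_symm_apply]
  · intro h
    refine h.reindex (icoSumEquiv hst htN) fun i j => ?_
    rw [key, key]

theorem seaweedPerm_mem (hS : IsBlockSum s N cS) (hT : IsBlockSum s N cT) {i : ℤ} (hi : s ≤ i)
    (hi' : i < N) : s ≤ seaweedPerm cS cT i ∧ seaweedPerm cS cT i < N :=
  ⟨hT.lo _ (hS.lo i hi hi') (hS.hi i hi hi'), hT.hi _ (hS.lo i hi hi') (hS.hi i hi hi')⟩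

/-- Equal first blocks split off a full matrix algebra, and the two reversals cancel on them. -/
theorem hasIncidenceIndex_seaweed_of_eq (hS : IsBlockSum s N cS) (hT : IsBlockSum s N cT)
    (hs : s < N) (heq : cS s = cT s)
    (ih : HasIncidenceIndex (fun i j : Set.Ico (cS s - s + 1) N => seaweedRel cS cT i j)
      (Module.finrank ℂ (seaweedInvariants (cS s - s + 1) N cS cT))) :
    HasIncidenceIndex (fun i j : Set.Ico s N => seaweedRel cS cT i j)
      (Module.finrank ℂ (seaweedInvariants s N cS cT)) := by
  have h1 := hS.lo s le_rfl hs
  have h2 := hS.hi s le_rfl hs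
  have hst : s ≤ cS s - s + 1 := by omega
  have htN : cS s - s + 1 ≤ N := by omega
  rw [← finrank_seaweedInvariants_of_fixed hst htN, hasIncidenceIndex_icoSum hst htN]
  · refine HasIncidenceIndex.sum ?_ ?_ ?_ ?_ ih
    · rintro i j k
      have hmem : ∀ i : Set.Ico s (cS s - s + 1) ⊕ Set.Ico (cS s - s + 1) N,
          Sum.elim Subtype.val Subtype.val i ∈ Set.Ico s N := by
        rintro (⟨i, hi, hi'⟩ | ⟨i, hi, hi'⟩)
        · exact ⟨hi, hi'.trans_le htN⟩
        · exact ⟨hst.trans hi, hi'⟩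
      exact seaweedRel_trans hS hT (hmem i) (hmem j) (hmem k)
    · rintro ⟨j, hj, hj'⟩ ⟨i, hi, hi'⟩
      have h3 := hS.eq_of_le hs hi (by omega)
      have h4 := hS.lt_of_lt hs (i := j) (by omega) hj'
      simp only [seaweedRel, Sum.elim_inl, Sum.elim_inr]
      omega
    · rintro ⟨i, hi, hi'⟩ ⟨j, hj, hj'⟩
      have h3 := hT.eq_of_le hs hi (by omega)
      have h4 := hT.lt_of_lt hs (i := j) (by omega) hj'
      simp only [seaweedRel, Sum.elim_inl, Sum.elim_inr]
      omega
    · refine hasIncidenceIndex_card ?_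
      rintro ⟨i, hi, hi'⟩ ⟨j, hj, hj'⟩
      have h3 := hT.eq_of_le hs hi (by omega)
      have h4 := hT.eq_of_le hs hj (by omega)
      have h5 := hS.eq_of_le hs hi (by omega)
      have h6 := hS.eq_of_le hs hj (by omega)
      simp only [seaweedRel, Sum.elim_inl]
      omega
  · intro i hi hi'
    have h3 := hS.eq_of_le hs hi (by omega)
    have h4 := hT.eq_of_le hs (i := cS i - i) (by omega) (by omega)
    simp only [seaweedPerm]
    omega
  · intro i hi hi'
    exact (seaweedPerm_mem (hS.tail hs) (heq ▸ hT.tail hs) hi hi').1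

/-- With first blocks of sizes p and q, `hle` says 2p ≤ q. The class to eliminate is the first block
of `cS`, matched with its mirror image in the first block of `cT`. -/
theorem hasIncidenceIndex_seaweed_of_remove_class (hS : IsBlockSum s N cS)
    (hT : IsBlockSum s N cT) (hs : s < N) (hlt : cS s < cT s) (hle : 2 * cS s - 2 * s < cT s)
    (ih : ∀ cT', IsBlockSum (cS s - s + 1) N cT' →
      HasIncidenceIndex (fun i j : Set.Ico (cS s - s + 1) N => seaweedRel cS cT' i j)
        (Module.finrank ℂ (seaweedInvariants (cS s - s + 1) N cS cT'))) :
    HasIncidenceIndex (fun i j : Set.Ico s N => seaweedRel cS cT i j)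
      (Module.finrank ℂ (seaweedInvariants s N cS cT)) := by
  have h1 := hS.lo s le_rfl hs
  have h2 := hT.hi s le_rfl hs
  set t := cS s - s + 1 with ht
  set b := cT s - s with hb
  have hst : s ≤ t := by omega
  have htN : t ≤ N := by omega
  have hS1 : ∀ i, s ≤ i → i < t → cS i = cS s := fun i hi hi' => hS.eq_of_le hs hi (by omega)
  have hS2 : ∀ i, t ≤ i → i < N → cS s < cS i ∧ cS s - s < cS i - i :=
    fun i hi hi' => hS.lt_of_lt hs (by omega) hi'
  have hT1 : ∀ i, s ≤ i → i ≤ b → cT i = cT s := fun i hi hi' => hT.eq_of_le hs hi hi'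
  have hT2 : ∀ i, b < i → i < N → cT s < cT i ∧ b < cT i - i :=
    fun i hi hi' => hT.lt_of_lt hs hi hi'
  -- Without its first p points the first block of `cT` splits: the mirror image `[cT s - t + 1, b]`
  -- becomes a block of its own, and `[t, cT s - t]`, possibly empty, keeps the old value since its
  -- endpoints still sum to `cT s`.
  let cT' : ℤ → ℤ := fun j => if cT s - t < j ∧ j ≤ b then cT s - t + 1 + b else cT j
  have hcin : ∀ j, cT s - t < j → j ≤ b → cT' j = cT s - t + 1 + b := fun j hj hj' =>
    if_pos ⟨hj, hj'⟩
  have hcout : ∀ j, ¬ (cT s - t < j ∧ j ≤ b) → cT' j = cT j := fun j hj => if_neg hj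
  have hT' : IsBlockSum t N cT' := by
    refine ⟨fun i j hi hij hj => ?_, fun i hi hi' => ?_, fun i hi hi' => ?_, fun i hi hi' => ?_⟩
    · by_cases hi1 : cT s - t < i ∧ i ≤ b <;> by_cases hj1 : cT s - t < j ∧ j ≤ b
      · rw [hcin i hi1.1 hi1.2, hcin j hj1.1 hj1.2]
      · rw [hcin i hi1.1 hi1.2, hcout j hj1]
        have := hT2 j (by omega) hj
        omega
      · rw [hcout i hi1, hcin j hj1.1 hj1.2, hT1 i (by omega) (by omega)]
        omega
      · rw [hcout i hi1, hcout j hj1]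
        exact hT.mono i j (by omega) hij hj
    · by_cases hi1 : cT s - t < i ∧ i ≤ b
      · rw [hcin i hi1.1 hi1.2]
        omega
      · rw [hcout i hi1]
        by_cases hi2 : i ≤ b
        · rw [hT1 i (by omega) hi2]
          omega
        · have := hT2 i (by omega) hi'
          omega
    · by_cases hi1 : cT s - t < i ∧ i ≤ b
      · rw [hcin i hi1.1 hi1.2]
        omega
      · rw [hcout i hi1]
        exact hT.hi i (by omega) hi'
    · by_cases hi1 : cT s - t < i ∧ i ≤ b
      · rw [hcin i hi1.1 hi1.2, hcin _ (by omega) (by omega)]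
      · rw [hcout i hi1, hcout, hT.inv i (by omega) hi']
        by_cases hi2 : i ≤ b
        · rw [hT1 i (by omega) hi2]
          omega
        · have := hT2 i (by omega) hi'
          omega
  have hrec := ih cT' hT'
  rw [finrank_seaweedInvariants_of_return (s := s) (cS := cS) (cT := cT) hst _ _ _ _ htN] at hrec
  · rw [hasIncidenceIndex_icoSum hst htN]
    have hmem : ∀ i : Set.Ico s t ⊕ Set.Ico t N,
        Sum.elim Subtype.val Subtype.val i ∈ Set.Ico s N := by
      rintro (⟨i, hi, hi'⟩ | ⟨i, hi, hi'⟩)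
      · exact ⟨hi, hi'.trans_le htN⟩
      · exact ⟨hst.trans hi, hi'⟩
    -- The matching is the reversal of the first block of `cT`.
    let e : Set.Ico s t → Set.Ico t N := fun p => ⟨cT s - p, by
      obtain ⟨p, hp, hp'⟩ := p
      constructor <;> dsimp only <;> omega⟩
    have hrange : ∀ j : Set.Ico t N, j ∈ Set.range e ↔ cT s - t < j ∧ (j : ℤ) ≤ b := by
      rintro ⟨j, hj, hj'⟩
      constructor
      · rintro ⟨⟨p, hp, hp'⟩, hpj⟩
        have : cT s - p = j := congrArg Subtype.val hpj
        dsimp only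
        omega
      · rintro ⟨h, h'⟩
        dsimp only at h h'
        exact ⟨⟨cT s - j, by omega, by omega⟩, Subtype.ext (by simp [e])⟩
    refine HasIncidenceIndex.of_remove_class (up := fun j : Set.Ico t N => (j : ℤ) ≤ b) (e := e)
      (fun i j k => seaweedRel_trans hS hT (hmem i) (hmem j) (hmem k))
      (fun i => seaweedRel_refl _) ?_ ?_ ?_ ?_ ?_ ?_ ?_ hrec
    · rintro ⟨p, hp⟩ ⟨q, hq⟩ hpq
      have : cT s - p = cT s - q := congrArg Subtype.val hpq
      exact Subtype.ext (by dsimp only; omega)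
    · rintro ⟨i, hi, hi'⟩ ⟨j, hj, hj'⟩
      have h3 := hT1 i hi (by omega)
      have h4 := hT1 j hj (by omega)
      have h5 := hS1 i hi (by omega)
      have h6 := hS1 j hj (by omega)
      simp only [seaweedRel, Sum.elim_inl]
      omega
    · rintro ⟨j, hj, hj'⟩ ⟨i, hi, hi'⟩
      have h3 := hS1 i hi (by omega)
      have h4 := hS2 j (by omega) hj'
      simp only [seaweedRel, Sum.elim_inl, Sum.elim_inr]
      omega
    · rintro ⟨i, hi, hi'⟩ ⟨j, hj, hj'⟩
      have h3 := hT1 i hi (by omega)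
      simp only [seaweedRel, Sum.elim_inl, Sum.elim_inr]
      constructor
      · intro h
        by_contra h4
        have := hT2 j (by omega) hj'
        omega
      · intro h
        have := hT1 j (by omega) h
        omega
    · rintro ⟨i, hi, hi'⟩
      simp only [e]
      omega
    · rintro ⟨j, hj, hj'⟩ hup hje ⟨i, hi, hi'⟩
      rw [hrange] at hje
      dsimp only at hup hje
      have h3 := hT1 j (by omega) hup
      have h4 := hT1 (cT s - i) (by omega) (by omega)
      simp only [seaweedRel, Sum.elim_inr, e]
      omega
    · rintro ⟨i, hi, hi'⟩ ⟨j, hj, hj'⟩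
      rw [hrange, hrange]
      simp only [seaweedRel, Sum.elim_inr]
      by_cases hi1 : cT s - t < i ∧ i ≤ b <;> by_cases hj1 : cT s - t < j ∧ j ≤ b
      · rw [hcin i hi1.1 hi1.2, hcin j hj1.1 hj1.2]
        have h3 := hT1 i (by omega) hi1.2
        have h4 := hT1 j (by omega) hj1.2
        omega
      · rw [hcin i hi1.1 hi1.2, hcout j hj1]
        have h3 := hT1 i (by omega) hi1.2
        by_cases hj2 : j ≤ b
        · have h4 := hT1 j (by omega) hj2
          omega
        · have h4 := hT2 j (by omega) hj'
          omega
      · rw [hcout i hi1, hcin j hj1.1 hj1.2]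
        have h3 := hT1 j (by omega) hj1.2
        by_cases hi2 : i ≤ b
        · have h4 := hT1 i (by omega) hi2
          omega
        · have h4 := hT2 i (by omega) hi'
          omega
      · rw [hcout i hi1, hcout j hj1]
        omega
  · intro i hi hi'
    have h3 := hS1 i hi hi'
    have h4 := hT1 (cS i - i) (by omega) (by omega)
    simp only [seaweedPerm]
    omega
  · intro i hi hi'
    exact seaweedPerm_mem hS hT hi hi'
  · intro i hi hi' h
    have h3 := hS2 i hi hi'
    have h4 := hS.hi i (by omega) hi'
    simp only [seaweedPerm] at h ⊢
    rw [hcout]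
    rintro ⟨h5, h6⟩
    have h7 := hT1 (cS i - i) (by omega) (by omega)
    omega
  · intro i hi hi' h
    have h3 := hS2 i hi hi'
    have h4 := hS.hi i (by omega) hi'
    simp only [seaweedPerm] at h ⊢
    have h5 : cS i - i ≤ b := by
      by_contra h5
      have := hT2 (cS i - i) (by omega) h4
      omega
    have h6 := hT1 (cS i - i) (by omega) h5
    rw [h6] at h ⊢
    have h7 := hS1 (cT s - (cS i - i)) (by omega) (by omega)
    rw [h7, hcin _ (by omega) h5, hT1 (cS s - (cT s - (cS i - i))) (by omega) (by omega)]
    omega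

/-- The block function obtained by removing initial points of the first block `[s, c s - s]`, so
that this block starts at `t`. -/
def truncateFirstBlock (s t : ℤ) (c : ℤ → ℤ) (j : ℤ) : ℤ :=
  if j ≤ c s - s then c s + (t - s) else c j

theorem truncateFirstBlock_of_le {s t j : ℤ} (hj : j ≤ c s - s) :
    truncateFirstBlock s t c j = c s + (t - s) := if_pos hj

theorem truncateFirstBlock_of_lt {s t j : ℤ} (hj : c s - s < j) :
    truncateFirstBlock s t c j = c j := if_neg (not_le.2 hj)

theorem IsBlockSum.truncateFirstBlock (h : IsBlockSum s N c) (hs : s < N) {t : ℤ} (hst : s ≤ t)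
    (ht : t ≤ c s - s + 1) : IsBlockSum t N (truncateFirstBlock s t c) := by
  have h1 := h.lo s le_rfl hs
  have h2 := h.hi s le_rfl hs
  have h3 : ∀ i, c s - s < i → i < N → c s < c i ∧ c s - s < c i - i :=
    fun i hi hi' => h.lt_of_lt hs hi hi'
  refine ⟨fun i j hi hij hj => ?_, fun i hi hi' => ?_, fun i hi hi' => ?_, fun i hi hi' => ?_⟩
  · rcases le_or_gt i (c s - s) with hi1 | hi1 <;> rcases le_or_gt j (c s - s) with hj1 | hj1
    · rw [truncateFirstBlock_of_le hi1, truncateFirstBlock_of_le hj1]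
    · rw [truncateFirstBlock_of_le hi1, truncateFirstBlock_of_lt hj1]
      have := h3 j hj1 hj
      omega
    · omega
    · rw [truncateFirstBlock_of_lt hi1, truncateFirstBlock_of_lt hj1]
      exact h.mono i j (by omega) hij hj
  · rcases le_or_gt i (c s - s) with hi1 | hi1
    · rw [truncateFirstBlock_of_le hi1]
      omega
    · rw [truncateFirstBlock_of_lt hi1]
      have := h3 i hi1 hi'
      omega
  · rcases le_or_gt i (c s - s) with hi1 | hi1
    · rw [truncateFirstBlock_of_le hi1]
      omega
    · rw [truncateFirstBlock_of_lt hi1]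
      exact h.hi i (by omega) hi'
  · rcases le_or_gt i (c s - s) with hi1 | hi1
    · rw [truncateFirstBlock_of_le hi1, truncateFirstBlock_of_le (by omega)]
    · have := h3 i hi1 hi'
      rw [truncateFirstBlock_of_lt hi1, truncateFirstBlock_of_lt (by omega),
        h.inv i (by omega) hi']

/-- Here p < q < 2p and d = q - p. The first d points are matched with the last d points of the
first block of `cT`, which lie beyond the first block of `cS`. On the first block of `cS` the
permutation is i ↦ i + d, before and after the truncation, so removed points re-enter at once. -/
theorem hasIncidenceIndex_seaweed_of_remove_subclass (hS : IsBlockSum s N cS)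
    (hT : IsBlockSum s N cT) (hs : s < N) (hlt : cS s < cT s) (hle : cT s ≤ 2 * cS s - 2 * s)
    (ih : ∀ cS' cT', IsBlockSum (s + (cT s - cS s)) N cS' → IsBlockSum (s + (cT s - cS s)) N cT' →
      HasIncidenceIndex (fun i j : Set.Ico (s + (cT s - cS s)) N => seaweedRel cS' cT' i j)
        (Module.finrank ℂ (seaweedInvariants (s + (cT s - cS s)) N cS' cT'))) :
    HasIncidenceIndex (fun i j : Set.Ico s N => seaweedRel cS cT i j)
      (Module.finrank ℂ (seaweedInvariants s N cS cT)) := by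
  have h1 := hS.lo s le_rfl hs
  have h2 := hT.hi s le_rfl hs
  set d := cT s - cS s with hd
  set t := s + d with ht
  set a := cS s - s with ha
  set b := cT s - s with hb
  have hst : s ≤ t := by omega
  have hta : t ≤ a + 1 := by omega
  have haN : a + 1 ≤ N := by omega
  have htN : t ≤ N := by omega
  have hsa : s ≤ a + 1 := by omega
  have hS1 : ∀ i, s ≤ i → i ≤ a → cS i = cS s := fun i hi hi' => hS.eq_of_le hs hi (by omega)
  have hS2 : ∀ i, a < i → i < N → cS s < cS i ∧ a < cS i - i :=
    fun i hi hi' => hS.lt_of_lt hs (by omega) hi'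
  have hT1 : ∀ i, s ≤ i → i ≤ b → cT i = cT s := fun i hi hi' => hT.eq_of_le hs hi hi'
  have hT2 : ∀ i, b < i → i < N → cT s < cT i ∧ b < cT i - i :=
    fun i hi hi' => hT.lt_of_lt hs hi hi'
  obtain ⟨cS', hS', hSin, hSout⟩ : ∃ cS', IsBlockSum t N cS' ∧ (∀ j, j ≤ a → cS' j = cS s + d) ∧
      ∀ j, a < j → cS' j = cS j :=
    ⟨_, hS.truncateFirstBlock hs hst (by omega), fun j hj => (truncateFirstBlock_of_le hj).trans
      (by omega), fun j hj => truncateFirstBlock_of_lt hj⟩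
  obtain ⟨cT', hT', hTin, hTout⟩ : ∃ cT', IsBlockSum t N cT' ∧ (∀ j, j ≤ b → cT' j = cT s + d) ∧
      ∀ j, b < j → cT' j = cT j :=
    ⟨_, hT.truncateFirstBlock hs hst (by omega), fun j hj => (truncateFirstBlock_of_le hj).trans
      (by omega), fun j hj => truncateFirstBlock_of_lt hj⟩
  have hrec := ih cS' cT' hS' hT'
  rw [finrank_seaweedInvariants_of_return (s := s) (cS := cS) (cT := cT) hst _ _ _ _ htN] at hrec
  · have hrec' := (hasIncidenceIndex_icoSum hta haN _).1 hrec
    let E : Set.Ico s N ≃ (Set.Ico s t ⊕ Set.Ico t (a + 1)) ⊕ Set.Ico (a + 1) N :=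
      (icoSumEquiv hsa haN).trans (Equiv.sumCongr (icoSumEquiv hst hta) (Equiv.refl _))
    let val : (Set.Ico s t ⊕ Set.Ico t (a + 1)) ⊕ Set.Ico (a + 1) N → ℤ :=
      Sum.elim (Sum.elim Subtype.val Subtype.val) Subtype.val
    have hE : ∀ i, val (E i) = i := by
      intro i
      rw [← sumElim_icoSumEquiv hsa haN i]
      simp only [E, Equiv.trans_apply]
      rcases icoSumEquiv hsa haN i with j | j
      · exact sumElim_icoSumEquiv hst hta j
      · rfl
    have hmem : ∀ i, val i ∈ Set.Ico s N := by
      rintro ((⟨i, hi, hi'⟩ | ⟨i, hi, hi'⟩) | ⟨i, hi, hi'⟩)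
      · exact ⟨hi, hi'.trans_le htN⟩
      · exact ⟨hst.trans hi, hi'.trans_le haN⟩
      · exact ⟨hsa.trans hi, hi'⟩
    have hmemA : ∀ i : Set.Ico s t ⊕ Set.Ico t (a + 1), s ≤ val (.inl i) ∧ val (.inl i) ≤ a := by
      rintro (⟨i, hi, hi'⟩ | ⟨i, hi, hi'⟩)
      · exact ⟨hi, show i ≤ a by omega⟩
      · exact ⟨hst.trans hi, show i ≤ a by omega⟩
    have hmem' : ∀ i : Set.Ico t (a + 1) ⊕ Set.Ico (a + 1) N,
        Sum.elim Subtype.val Subtype.val i ∈ Set.Ico t N := by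
      rintro (⟨i, hi, hi'⟩ | ⟨i, hi, hi'⟩)
      · exact ⟨hi, hi'.trans_le haN⟩
      · exact ⟨hta.trans hi, hi'⟩
    refine HasIncidenceIndex.reindex E (R' := fun x y => seaweedRel cS cT (val x) (val y))
      (fun i j => by rw [hE, hE]) ?_
    let e : Set.Ico s t → Set.Ico (a + 1) N := fun p => ⟨cT s - p, by
      obtain ⟨p, hp, hp'⟩ := p
      constructor <;> dsimp only <;> omega⟩
    have hrange : ∀ j : Set.Ico (a + 1) N, j ∈ Set.range e ↔ (j : ℤ) ≤ b := by
      rintro ⟨j, hj, hj'⟩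
      constructor
      · rintro ⟨⟨p, hp, hp'⟩, hpj⟩
        have : cT s - p = j := congrArg Subtype.val hpj
        dsimp only
        omega
      · intro h
        dsimp only at h
        exact ⟨⟨cT s - j, by omega, by omega⟩, Subtype.ext (by simp [e])⟩
    refine HasIncidenceIndex.of_remove_subclass (e := e)
      (R := fun x y => seaweedRel cS cT (val x) (val y))
      (R' := fun x y : Set.Ico t (a + 1) ⊕ Set.Ico (a + 1) N => seaweedRel cS' cT'
        (Sum.elim Subtype.val Subtype.val x) (Sum.elim Subtype.val Subtype.val y))
      (fun i j k => seaweedRel_trans hS hT (hmem i) (hmem j) (hmem k))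
      (fun i => seaweedRel_refl _)
      (fun i j k => seaweedRel_trans hS' hT' (hmem' i) (hmem' j) (hmem' k))
      ?_ ?_ ?_ ?_ ?_ ?_ ?_ ?_ hrec'
    · rintro ⟨p, hp⟩ ⟨q, hq⟩ hpq
      have : cT s - p = cT s - q := congrArg Subtype.val hpq
      exact Subtype.ext (by dsimp only; omega)
    · intro i j
      have hi := hmemA i
      have hj := hmemA j
      have h3 := hT1 _ hi.1 (by omega)
      have h4 := hT1 _ hj.1 (by omega)
      have h5 := hS1 _ hi.1 hi.2
      have h6 := hS1 _ hj.1 hj.2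
      simp only [seaweedRel]
      omega
    · rintro ⟨j, hj, hj'⟩ i
      have hi := hmemA i
      have h3 := hS1 _ hi.1 hi.2
      have h4 := hS2 j (by omega) hj'
      have hv : val (.inr ⟨j, hj, hj'⟩) = j := rfl
      simp only [seaweedRel, hv]
      omega
    · rintro i ⟨j, hj, hj'⟩
      have hi := hmemA i
      have h3 := hT1 _ hi.1 (by omega)
      have hv : val (.inr ⟨j, hj, hj'⟩) = j := rfl
      rw [hrange]
      simp only [seaweedRel, hv]
      constructor
      · intro h
        by_contra h4
        have := hT2 j (by omega) hj'
        omega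
      · intro h
        have := hT1 j (by omega) h
        omega
    · rintro ⟨i, hi, hi'⟩ ⟨j, hj, hj'⟩
      simp only [seaweedRel, Sum.elim_inl]
      rw [hSin i (by omega), hSin j (by omega), hTin i (by omega), hTin j (by omega)]
      omega
    · rintro ⟨j, hj, hj'⟩ ⟨i, hi, hi'⟩
      have h4 := hS2 j (by omega) hj'
      have h5 := hS2 (a + 1) (by omega) (by omega)
      have h6 := hS.mono (a + 1) j (by omega) (by omega) hj'
      simp only [seaweedRel, Sum.elim_inl, Sum.elim_inr]
      rw [hSin i (by omega), hSout j (by omega)]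
      omega
    · rintro ⟨i, hi, hi'⟩ ⟨j, hj, hj'⟩
      rw [hrange]
      simp only [seaweedRel, Sum.elim_inl, Sum.elim_inr]
      rw [hTin i (by omega)]
      by_cases hjb : j ≤ b
      · rw [hTin j hjb]
        omega
      · rw [hTout j (by omega)]
        have h3 := hT2 j (by omega) hj'
        omega
    · rintro ⟨i, hi, hi'⟩ ⟨j, hj, hj'⟩
      have hvi : val (.inr ⟨i, hi, hi'⟩) = i := rfl
      have hvj : val (.inr ⟨j, hj, hj'⟩) = j := rfl
      simp only [seaweedRel, Sum.elim_inr, hvi, hvj]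
      rw [hSout i (by omega), hSout j (by omega)]
      by_cases hib : i ≤ b <;> by_cases hjb : j ≤ b
      · have h3 := hT1 i (by omega) hib
        have h4 := hT1 j (by omega) hjb
        rw [hTin i hib, hTin j hjb]
        omega
      · have h3 := hT1 i (by omega) hib
        have h4 := hT2 j (by omega) hj'
        rw [hTin i hib, hTout j (by omega)]
        omega
      · have h3 := hT2 i (by omega) hi'
        have h4 := hT1 j (by omega) hjb
        rw [hTout i (by omega), hTin j hjb]
        omega
      · rw [hTout i (by omega), hTout j (by omega)]
  · intro i hi hi'
    have h3 := hS1 i hi (by omega)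
    have h4 := hT1 (cS i - i) (by omega) (by omega)
    simp only [seaweedPerm]
    omega
  · intro i hi hi'
    exact seaweedPerm_mem hS hT hi hi'
  · intro i hi hi' h
    simp only [seaweedPerm] at h ⊢
    by_cases hia : i ≤ a
    · rw [hSin i hia, hS1 i (by omega) hia, hTin _ (by omega),
        hT1 (cS s - i) (by omega) (by omega)]
      omega
    · have h3 := hS2 i (by omega) hi'
      rw [hSout i (by omega), hTout]
      by_contra h5
      have h6 := hT1 (cS i - i) (by omega) (by omega)
      omega
  · intro i hi hi' h
    simp only [seaweedPerm] at h ⊢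
    have hia : a < i := by
      by_contra hia
      rw [hS1 i (by omega) (by omega), hT1 (cS s - i) (by omega) (by omega)] at h
      omega
    have h3 := hS2 i hia hi'
    have h4 := hS.hi i (by omega) hi'
    have h5 : cS i - i ≤ b := by
      by_contra h5
      have := hT2 (cS i - i) (by omega) h4
      omega
    rw [hT1 (cS i - i) (by omega) h5, hSout i hia, hTin _ h5,
      hS1 (cT s - (cS i - i)) (by omega) (by omega),
      hT1 (cS s - (cT s - (cS i - i))) (by omega) (by omega)]
    omega

/-- The index of a seaweed algebra is the number of cycles of the composition of the two block
reversals. -/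
theorem hasIncidenceIndex_seaweed (n : ℕ) : ∀ (s : ℤ) (cS cT : ℤ → ℤ), IsBlockSum s N cS →
    IsBlockSum s N cT → N - s ≤ n →
    HasIncidenceIndex (fun i j : Set.Ico s N => seaweedRel cS cT i j)
      (Module.finrank ℂ (seaweedInvariants s N cS cT)) := by
  induction n with
  | zero =>
    intro s cS cT hS hT hn
    have hN : N ≤ s := by simpa using hn
    have : IsEmpty (Set.Ico s N) := ⟨fun i => absurd (i.2.1.trans_lt i.2.2) (not_lt.2 hN)⟩
    have h0 : Module.finrank ℂ (seaweedInvariants s N cS cT) = 0 := by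
      have : seaweedInvariants s N cS cT = ⊥ := by
        rw [eq_bot_iff]
        intro φ hφ
        ext i
        exact hφ.1 i (by omega)
      rw [this, finrank_bot]
    rw [h0]
    exact ⟨⟨0, (Module.finrank_zero_of_subsingleton).le⟩, fun _ => Nat.zero_le _⟩
  | succ n ih =>
    intro s cS cT hS hT hn
    by_cases hs : s < N
    · have main : ∀ cS cT, IsBlockSum s N cS → IsBlockSum s N cT → cS s < cT s →
          HasIncidenceIndex (fun i j : Set.Ico s N => seaweedRel cS cT i j)
            (Module.finrank ℂ (seaweedInvariants s N cS cT)) := by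
        intro cS cT hS hT hlt
        have h1 := hS.lo s le_rfl hs
        by_cases h : 2 * cS s - 2 * s < cT s
        · refine hasIncidenceIndex_seaweed_of_remove_class hS hT hs hlt h fun cT' hT' => ?_
          exact ih _ _ _ (hS.tail hs) hT' (by push_cast at hn; omega)
        · refine hasIncidenceIndex_seaweed_of_remove_subclass hS hT hs hlt (not_lt.1 h)
            fun cS' cT' hS' hT' => ?_
          exact ih _ _ _ hS' hT' (by push_cast at hn; omega)
      rcases lt_trichotomy (cS s) (cT s) with h | h | h
      · exact main cS cT hS hT h
      · refine hasIncidenceIndex_seaweed_of_eq hS hT hs h ?_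
        have h1 := hS.lo s le_rfl hs
        refine ih _ _ _ (hS.tail hs) ?_ (by push_cast at hn; omega)
        rw [h]
        exact hT.tail hs
      · have h1 := (main cT cS hT hS h).swap
        rw [seaweedInvariants_swap hS hT]
        refine h1.reindex (Equiv.refl _) fun i j => ?_
        simp only [seaweedRel, Equiv.refl_apply]
        rw [or_comm, eq_comm (a := cS i), eq_comm (a := cT i)]
    · exact ih s cS cT hS hT (by omega)

end SeaweedInduction

/-! ### Counting the orbits of the return map on blocks. -/

section Counting

/-- The `m`-periodic functions on `ℤ` invariant under `k ↦ C + ε * k`. -/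
def affineInvariants (m ε C : ℤ) : Submodule ℂ (ℤ → ℂ) where
  carrier := {θ | (∀ k, θ (k + m) = θ k) ∧ ∀ k, θ (C + ε * k) = θ k}
  zero_mem' := by simp
  add_mem' := by
    rintro φ ψ ⟨h1, h2⟩ ⟨h3, h4⟩
    exact ⟨fun i => by simp [h1 i, h3 i], fun i => by simp [h2 i, h4 i]⟩
  smul_mem' := by
    rintro c φ ⟨h1, h2⟩
    exact ⟨fun i => by simp [h1 i], fun i => by simp [h2 i]⟩

theorem apply_emod_of_periodic {m : ℤ} {θ : ℤ → ℂ} (h : ∀ k, θ (k + m) = θ k) (k : ℤ) :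
    θ (k % m) = θ k := by
  have hp : Function.Periodic θ m := h
  have := hp.int_mul (k / m) (k % m)
  rw [← this]
  congr 1
  have := Int.emod_add_mul_ediv k m
  push_cast
  linarith

theorem nonempty_affineInvariants_one_equiv (m : ℤ) :
    Nonempty (affineInvariants m 1 1 ≃ₗ[ℂ] (Fin 1 → ℂ)) := by
  let T : affineInvariants m 1 1 →ₗ[ℂ] (Fin 1 → ℂ) :=
    { toFun := fun θ _ => θ.1 0
      map_add' := fun _ _ => rfl
      map_smul' := fun _ _ => rfl }
  refine ⟨LinearEquiv.ofBijective T ⟨?_, fun f => ?_⟩⟩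
  · have hconst : ∀ θ ∈ affineInvariants m 1 1, ∀ k, θ k = θ 0 := by
      rintro θ ⟨-, h⟩ k
      have hp : Function.Periodic θ 1 := fun k => by rw [← h k, one_mul, add_comm]
      simpa using hp.int_mul_eq k
    rintro ⟨θ, hθ⟩ ⟨θ', hθ'⟩ h
    ext k
    change θ k = θ' k
    rw [hconst θ hθ, hconst θ' hθ']
    exact congrFun h 0
  · refine ⟨⟨fun _ => f 0, fun _ => rfl, fun _ => rfl⟩, ?_⟩
    ext i
    rw [Subsingleton.elim i 0]
    rfl

/-- In the coordinate j = k - c the reflection is j ↦ -ε - j, and each of its orbits on ℤ/m has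
exactly one representative between 0 and (m - ε)/2. -/
theorem nonempty_affineInvariants_neg_one_equiv {m : ℕ} (hm : 0 < m) (c : ℤ) {ε : ℕ} (hε : ε ≤ 1) :
    Nonempty (affineInvariants m (-1) (2 * c - ε) ≃ₗ[ℂ] (Fin ((m - ε) / 2 + 1) → ℂ)) := by
  let T : affineInvariants m (-1) (2 * c - ε) →ₗ[ℂ] (Fin ((m - ε) / 2 + 1) → ℂ) :=
    { toFun := fun θ j => θ.1 (c + (j : ℕ))
      map_add' := fun _ _ => rfl
      map_smul' := fun _ _ => rfl }
  -- The representative of the orbit of j. Both arguments of `min` are nonnegative because ε ≤ 1, so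
  -- `toNat` truncates nothing.
  let g : ℤ → ℕ := fun j => (min (j % m) (m - ε - j % m)).toNat
  have hlo : ∀ j : ℤ, 0 ≤ j % m := fun j => Int.emod_nonneg _ (by omega)
  have hhi : ∀ j : ℤ, j % m < m := fun j => Int.emod_lt_of_pos _ (by omega)
  have hg : ∀ j, g j < (m - ε) / 2 + 1 := by
    intro j
    have h1 := hlo j
    have h2 := hhi j
    simp only [g]
    omega
  have hT : ∀ θ : affineInvariants m (-1) (2 * c - ε), ∀ j : ℤ,
      θ.1 (c + j) = T θ ⟨g j, hg j⟩ := by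
    rintro ⟨θ, h1, h2⟩ j
    have h3 := hlo j
    have h4 := hhi j
    change θ (c + j) = θ (c + (g j : ℕ))
    have h5 : θ (c + j) = θ (c + j % m) := by
      rw [← apply_emod_of_periodic h1, ← apply_emod_of_periodic h1 (c + j % m)]
      simp
    rw [h5]
    rcases le_total (j % m) (m - ε - j % m) with h | h
    · congr 2
      simp only [g]
      omega
    · rw [← h2, ← h1]
      congr 1
      simp only [g]
      omega
  refine ⟨LinearEquiv.ofBijective T ⟨fun θ θ' h => ?_, fun f => ?_⟩⟩
  · ext k
    have h1 := hT θ (k - c)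
    have h2 := hT θ' (k - c)
    rw [add_sub_cancel] at h1 h2
    rw [h1, h2, h]
  · have hper : ∀ k, g (k + m) = g k := fun k => by simp [g]
    have hrefl : ∀ k, g (-ε - k) = g k := by
      intro k
      have h1 := hlo k
      have h2 := hhi k
      have h3 : (-ε - k) % m = (m - ε - k % m) % m := by
        have h4 : -ε - k = m - ε - k % m + m * (-(k / m) - 1) := by
          linear_combination Int.emod_add_mul_ediv k m
        rw [h4, Int.add_mul_emod_self_left]
      simp only [g]
      rw [h3]
      by_cases h4 : k % m = 0 ∧ ε = 0
      · rw [h4.1, h4.2]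
        simp
      · rw [Int.emod_eq_of_lt (by omega) (by omega)]
        omega
    refine ⟨⟨fun k => f ⟨g (k - c), hg _⟩, fun k => ?_, fun k => ?_⟩, ?_⟩
    · have h : g (k + m - c) = g (k - c) := by
        rw [← hper (k - c)]
        congr 1
        ring
      simp only [h]
    · have h : g (2 * c - ε + -1 * k - c) = g (k - c) := by
        rw [← hrefl (k - c)]
        congr 1
        ring
      simp only [h]
    · ext j
      change f ⟨g (c + (j : ℕ) - c), _⟩ = f j
      congr 1
      ext
      have h1 := j.2
      simp only [g, add_sub_cancel_left]
      rw [Int.emod_eq_of_lt (by omega) (by omega)]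
      omega

/-- The displacement of the block coordinate after `t` steps of the folded permutation. -/
def foldingShift (x y : ℕ) : ℕ → ℤ
  | 0 => 0
  | t + 1 => -foldingShift x y t - 1 + ((t * y % x + y) / x : ℕ)

/-- Modulo 2 signs disappear and the carries add up to ⌊ty/x⌋; at t = x the shift is congruent to x
+ y. -/
theorem foldingShift_parity (x y t : ℕ) :
    ∃ q : ℤ, foldingShift x y t = t + (t * y / x : ℕ) + 2 * q := by
  induction t with
  | zero => exact ⟨0, by simp [foldingShift]⟩
  | succ t ih =>
    obtain ⟨q, hq⟩ := ih
    have h : (t + 1) * y / x = t * y / x + (t * y % x + y) / x := by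
      rcases Nat.eq_zero_or_pos x with rfl | hx
      · simp
      · rw [add_mul, one_mul]
        conv_lhs => rw [← Nat.div_add_mod (t * y) x, add_assoc, Nat.mul_add_div hx]
    rw [foldingShift, hq, h]
    refine ⟨-q - t - (t * y / x : ℕ) - 1, ?_⟩
    push_cast
    ring

/-- Passing from y to y + 1 shifts z by one and flips the signs. The boundary terms contribute ⌊(x +
y)/x⌋ - ⌊y/x⌋ = 1, so the sum S(y) satisfies S(y + 1) = -(S(y) + 1). -/
theorem sum_neg_one_pow_mul_add_div {x : ℕ} (hx : Even x) (hx0 : 0 < x) (y : ℕ) :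
    ∑ z ∈ Finset.range x, (-1 : ℤ) ^ z * ((z + y) / x : ℕ) = if Odd y then -1 else 0 := by
  induction y with
  | zero =>
    rw [if_neg (by simp)]
    refine Finset.sum_eq_zero fun z hz => ?_
    rw [add_zero, Nat.div_eq_of_lt (Finset.mem_range.1 hz)]
    simp
  | succ y ih =>
    have h1 := Finset.sum_range_succ (fun z => (-1 : ℤ) ^ z * ((z + y) / x : ℕ)) x
    have h2 := Finset.sum_range_succ' (fun z => (-1 : ℤ) ^ z * ((z + y) / x : ℕ)) x
    have h3 : ∑ z ∈ Finset.range x, (-1 : ℤ) ^ z * ((z + (y + 1)) / x : ℕ) =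
        -∑ z ∈ Finset.range x, (-1 : ℤ) ^ (z + 1) * ((z + 1 + y) / x : ℕ) := by
      rw [← Finset.sum_neg_distrib]
      refine Finset.sum_congr rfl fun z _ => ?_
      rw [add_assoc, add_comm 1 y, pow_succ]
      ring
    have h4 : ((x + y) / x : ℕ) = y / x + 1 := Nat.add_div_left y hx0
    rw [ih, h4, hx.neg_one_pow] at h1
    rw [h3]
    simp only [Nat.odd_add_one] at *
    push_cast at *
    by_cases hy : Odd y <;> simp only [hy, if_true, if_false, not_true_eq_false,
      not_false_eq_true] at * <;> simp at h2 ⊢ <;> linarith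

theorem bijective_mul_mod {x y : ℕ} (hx : 0 < x) (h : Nat.Coprime x y) :
    Function.Bijective fun t : Fin x => (⟨t * y % x, Nat.mod_lt _ hx⟩ : Fin x) := by
  refine Finite.injective_iff_bijective.1 fun t t' htt' => ?_
  have h1 : (t : ℕ) * y ≡ t' * y [MOD x] := congrArg Fin.val htt'
  have h2 := Nat.ModEq.cancel_right_of_coprime h h1
  exact Fin.ext (Nat.ModEq.eq_of_lt_of_lt h2 t.2 t'.2)

theorem neg_one_pow_mul_foldingShift (x y t : ℕ) :
    (-1) ^ t * foldingShift x y t =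
      ∑ i ∈ Finset.range t, (-1 : ℤ) ^ i * (1 - ((i * y % x + y) / x : ℕ)) := by
  induction t with
  | zero => simp [foldingShift]
  | succ t ih =>
    rw [Finset.sum_range_succ, ← ih, foldingShift, pow_succ]
    ring

/-- The shift is an alternating sum over the orbit of the rotation. Reordered by residues z it
becomes the sum evaluated above. -/
theorem foldingShift_self_of_even {x y : ℕ} (hx0 : 0 < x) (hx : Even x) (hy : Odd y)
    (h : Nat.Coprime x y) : foldingShift x y x = 1 := by
  have h1 := neg_one_pow_mul_foldingShift x y x
  rw [hx.neg_one_pow, one_mul] at h1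
  rw [h1]
  simp only [mul_sub, mul_one, Finset.sum_sub_distrib]
  have h2 : ∑ i ∈ Finset.range x, (-1 : ℤ) ^ i = 0 := by
    rw [neg_one_geom_sum, if_pos hx]
  have h3 : ∑ i ∈ Finset.range x, (-1 : ℤ) ^ i * ((i * y % x + y) / x : ℕ) =
      ∑ z ∈ Finset.range x, (-1 : ℤ) ^ z * ((z + y) / x : ℕ) := by
    rw [Finset.sum_range, Finset.sum_range]
    refine Fintype.sum_bijective _ (bijective_mul_mod hx0 h) _ _ fun t => ?_
    dsimp only
    congr 1
    -- With x even and y odd, the step number t and its residue ty mod x have the same parity, so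
    -- the reordering keeps the signs.
    have h4 : (-1 : ℤ) ^ ((t : ℕ) * y) = (-1) ^ ((t : ℕ) * y % x) := by
      conv_lhs => rw [← Nat.div_add_mod ((t : ℕ) * y) x, pow_add, pow_mul, hx.neg_one_pow, one_pow,
        one_mul]
    rw [← h4, mul_comm (t : ℕ) y, pow_mul, hy.neg_one_pow]
  rw [h2, h3, sum_neg_one_pow_mul_add_div hx hx0, if_pos hy]
  rfl

end Counting

/-! ### Folding the permutation of (a, …, a, b) to ℤ/ma. -/

section RepeatedBlocks

/-- The block function of the composition `(a, …, a, b)` of `m * a + b`. -/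
def repeatedBlock (a b m i : ℤ) : ℤ :=
  if i < m * a then (2 * (i / a) + 1) * a - 1 else 2 * (m * a) + b - 1

/-- The functions on `ℤ / (m * a)` invariant under the return map of the seaweed permutation of
`(a, …, a, b)`. -/
def foldedInvariants (a b m : ℤ) : Submodule ℂ (ℤ → ℂ) where
  carrier := {ψ | (∀ i, ψ (i + m * a) = ψ i) ∧ ∀ i, ψ (b - a - i + 2 * (i % a)) = ψ i}
  zero_mem' := by simp
  add_mem' := by
    rintro φ ψ ⟨h1, h2⟩ ⟨h3, h4⟩
    exact ⟨fun i => by simp [h1 i, h3 i], fun i => by simp [h2 i, h4 i]⟩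
  smul_mem' := by
    rintro c φ ⟨h1, h2⟩
    exact ⟨fun i => by simp [h1 i], fun i => by simp [h2 i]⟩

variable {a b m : ℤ}

theorem isBlockSum_repeatedBlock (ha : 0 < a) (hb : 0 < b) (hm : 0 < m) :
    IsBlockSum 0 (m * a + b) (repeatedBlock a b m) := by
  have hlt : ∀ i, i < m * a → i / a + 1 ≤ m := fun i hi => by
    have := Int.ediv_lt_of_lt_mul ha hi
    omega
  have hdiv : ∀ i : ℤ, 0 ≤ i % a ∧ i % a < a ∧ i = (i / a) * a + i % a := fun i =>
    ⟨Int.emod_nonneg _ ha.ne', Int.emod_lt_of_pos _ ha, by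
      rw [mul_comm]; exact (Int.mul_ediv_add_emod i a).symm⟩
  have hblock : ∀ i, i < m * a → repeatedBlock a b m i = 2 * ((i / a) * a) + a - 1 := by
    intro i hi
    rw [repeatedBlock, if_pos hi]
    ring
  have hlast : ∀ i, ¬ i < m * a → repeatedBlock a b m i = 2 * (m * a) + b - 1 :=
    fun i hi => if_neg hi
  have hmul : ∀ i, i < m * a → (i / a) * a + a ≤ m * a := by
    intro i hi
    have := mul_le_mul_of_nonneg_right (hlt i hi) ha.le
    linarith
  have hpos : 0 < m * a := mul_pos hm ha
  refine ⟨fun i j hi hij hj => ?_, fun i hi hi' => ?_, fun i hi hi' => ?_, fun i hi hi' => ?_⟩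
  · by_cases hj1 : j < m * a
    · rw [hblock i (by omega), hblock j hj1]
      have := mul_le_mul_of_nonneg_right (Int.ediv_le_ediv ha hij) ha.le
      omega
    · rw [hlast j hj1]
      by_cases hi1 : i < m * a
      · rw [hblock i hi1]
        have := hmul i hi1
        omega
      · rw [hlast i hi1]
  · by_cases hi1 : i < m * a
    · rw [hblock i hi1]
      have := hdiv i
      have : 0 ≤ (i / a) * a := mul_nonneg (Int.ediv_nonneg hi ha.le) ha.le
      omega
    · rw [hlast i hi1]
      omega
  · by_cases hi1 : i < m * a
    · rw [hblock i hi1]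
      have := hdiv i
      have := hmul i hi1
      omega
    · rw [hlast i hi1]
      omega
  · by_cases hi1 : i < m * a
    · have h1 := hdiv i
      have h2 := hmul i hi1
      have h3 : (2 * ((i / a) * a) + a - 1 - i) / a = i / a := by
        rw [Int.ediv_eq_iff_of_pos ha]
        constructor <;> linarith
      rw [hblock i hi1, hblock _ (by omega), h3]
    · rw [hlast i hi1, hlast _ (by omega)]

theorem isBlockSum_const (N : ℤ) : IsBlockSum 0 N fun _ => N - 1 :=
  ⟨fun _ _ _ _ _ => le_rfl, fun i _ _ => by omega, fun i _ _ => by omega,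
    fun _ _ _ => rfl⟩

/-- On the last block the permutation is subtraction of `m * a`, so an invariant function is the
restriction of an `m * a`-periodic one. The rule on the blocks of size `a` then makes sense modulo
`m * a`. -/
theorem finrank_seaweedInvariants_repeatedBlock (ha : 0 < a) (hb : 0 < b) (hm : 0 < m) :
    Module.finrank ℂ (seaweedInvariants 0 (m * a + b) (repeatedBlock a b m)
      fun _ => m * a + b - 1) = Module.finrank ℂ (foldedInvariants a b m) := by
  have hpos : 0 < m * a := mul_pos hm ha
  have hperm : ∀ i, i < m * a → seaweedPerm (repeatedBlock a b m) (fun _ => m * a + b - 1) i =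
      b - a - i + 2 * (i % a) + m * a := by
    intro i hi
    rw [seaweedPerm, repeatedBlock, if_pos hi]
    linear_combination (-2) * (Int.mul_ediv_add_emod i a)
  have hperm' : ∀ i, ¬ i < m * a → seaweedPerm (repeatedBlock a b m) (fun _ => m * a + b - 1) i =
      i - m * a := by
    intro i hi
    rw [seaweedPerm, repeatedBlock, if_neg hi]
    ring
  let T : foldedInvariants a b m →ₗ[ℂ] seaweedInvariants 0 (m * a + b) (repeatedBlock a b m)
      (fun _ => m * a + b - 1) :=
    { toFun := fun ψ => ⟨fun i => if 0 ≤ i ∧ i < m * a + b then ψ.1 i else 0, by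
        obtain ⟨ψ, h1, h2⟩ := ψ
        refine ⟨fun i hi => if_neg hi, fun i hi hi' => ?_⟩
        dsimp only
        rw [if_pos (seaweedPerm_mem (isBlockSum_repeatedBlock ha hb hm) (isBlockSum_const _) hi hi'),
          if_pos ⟨hi, hi'⟩]
        by_cases h : i < m * a
        · rw [hperm i h, h1, h2]
        · rw [hperm' i h, ← h1, sub_add_cancel]⟩
      map_add' := fun φ ψ => by
        ext i
        by_cases h : 0 ≤ i ∧ i < m * a + b <;> simp [h]
      map_smul' := fun c φ => by
        ext i
        by_cases h : 0 ≤ i ∧ i < m * a + b <;> simp [h] }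
  refine (LinearEquiv.ofBijective T ⟨?_, ?_⟩).finrank_eq.symm
  · rintro ⟨ψ, h1, h2⟩ ⟨ψ', h1', h2'⟩ h
    ext i
    change ψ i = ψ' i
    rw [← apply_emod_of_periodic h1, ← apply_emod_of_periodic h1']
    have h3 := Int.emod_nonneg i hpos.ne'
    have h4 := Int.emod_lt_of_pos i hpos
    have h5 : (if 0 ≤ i % (m * a) ∧ i % (m * a) < m * a + b then ψ (i % (m * a)) else 0) =
        if 0 ≤ i % (m * a) ∧ i % (m * a) < m * a + b then ψ' (i % (m * a)) else 0 :=
      congrFun (congrArg Subtype.val h) _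
    rwa [if_pos ⟨h3, by omega⟩, if_pos ⟨h3, by omega⟩] at h5
  · rintro ⟨φ, h1, h2⟩
    -- As b may exceed `m * a`, several subtractions can be needed, hence the induction.
    have hmod : ∀ n : ℕ, ∀ i, 0 ≤ i → i < m * a + b → i ≤ n → φ (i % (m * a)) = φ i := by
      intro n
      induction n with
      | zero =>
        intro i hi hi' hn
        have : i = 0 := by simp at hn; omega
        rw [this, Int.zero_emod]
      | succ n ih =>
        intro i hi hi' hn
        by_cases h : i < m * a
        · rw [Int.emod_eq_of_lt hi h]
        · have h3 := h2 i hi hi'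
          rw [hperm' i h] at h3
          rw [← h3, ← ih (i - m * a) (by omega) (by omega) (by push_cast at hn; omega),
            Int.sub_emod_right]
    have hmod' : ∀ i, 0 ≤ i → i < m * a + b → φ (i % (m * a)) = φ i := fun i hi hi' =>
      hmod i.toNat i hi hi' (by omega)
    refine ⟨⟨fun i => φ (i % (m * a)), fun i => ?_, fun i => ?_⟩, ?_⟩
    · dsimp only
      rw [Int.add_emod_right]
    · dsimp only
      have h3 := Int.emod_nonneg i hpos.ne'
      have h4 := Int.emod_lt_of_pos i hpos
      have h5 := h2 (i % (m * a)) h3 (by omega)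
      have h6 := seaweedPerm_mem (isBlockSum_repeatedBlock ha hb hm) (isBlockSum_const _) h3
        (show i % (m * a) < m * a + b by omega)
      rw [← hmod' _ h6.1 h6.2] at h5
      rw [← h5, hperm _ h4, Int.emod_emod_of_dvd i (Dvd.intro_left m rfl)]
      congr 1
      have h7 : b - a - i % (m * a) + 2 * (i % a) + m * a =
          b - a - i + 2 * (i % a) + m * a * (i / (m * a) + 1) := by
        linear_combination (-1) * Int.mul_ediv_add_emod i (m * a)
      rw [h7, Int.add_mul_emod_self_left]
    · ext i
      change (if 0 ≤ i ∧ i < m * a + b then φ (i % (m * a)) else 0) = φ i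
      by_cases h : 0 ≤ i ∧ i < m * a + b
      · rw [if_pos h, hmod' i h.1 h.2]
      · rw [if_neg h, h1 i h]

end RepeatedBlocks

/-! ### Splitting the folded permutation by residues modulo the gcd. -/

section Unfolding

/-- Integers as triples: block, position in the orbit of the rotation by `y` on `ℤ / x`, and
residue modulo `d`. -/
def orbitCoordinate (d x y : ℕ) (p : ℤ × Fin x × Fin d) : ℤ :=
  p.1 * (d * x : ℕ) + ((p.2.1 * y % x : ℕ) : ℤ) * d + (p.2.2 : ℕ)

theorem bijective_orbitCoordinate {d x y : ℕ} (hd : 0 < d) (hx : 0 < x) (h : Nat.Coprime x y) :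
    Function.Bijective (orbitCoordinate d x y) := by
  have key : ∀ (k : ℤ) (z r : ℕ), z < x → r < d →
      (k * (d * x : ℕ) + (z : ℤ) * d + r) / (d * x : ℕ) = k ∧
      (k * (d * x : ℕ) + (z : ℤ) * d + r) % (d * x : ℕ) = z * d + r := by
    intro k z r hz hr
    have h1 : ((z * d + r : ℕ) : ℤ) < (d * x : ℕ) := by
      have : (z + 1) * d ≤ x * d := Nat.mul_le_mul_right d hz
      have h' : z * d + r < d * x := by nlinarith
      exact_mod_cast h'
    have h0 : (0 : ℤ) < (d * x : ℕ) := by positivity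
    have h2 : k * (d * x : ℕ) + (z : ℤ) * d + r = ((z * d + r : ℕ) : ℤ) + (d * x : ℕ) * k := by
      push_cast
      ring
    rw [h2, Int.add_mul_ediv_left _ _ h0.ne', Int.add_mul_emod_self_left,
      Int.ediv_eq_zero_of_lt (by positivity) h1, Int.emod_eq_of_lt (by positivity) h1]
    push_cast
    simp
  constructor
  · rintro ⟨k, t, r⟩ ⟨k', t', r'⟩ hk
    simp only [orbitCoordinate] at hk
    have h1 := key k (t * y % x) r (Nat.mod_lt _ hx) r.2
    have h2 := key k' (t' * y % x) r' (Nat.mod_lt _ hx) r'.2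
    rw [hk] at h1
    have h3 : k = k' := h1.1.symm.trans h2.1
    have h4 : (t * y % x) * d + (r : ℕ) = (t' * y % x) * d + r' := by
      have := h1.2.symm.trans h2.2
      exact_mod_cast this
    have h5 : (r : ℕ) = r' := by
      have := congrArg (· % d) h4
      simpa [Nat.mod_eq_of_lt r.2, Nat.mod_eq_of_lt r'.2, Nat.mul_add_mod'] using this
    have h6 : (t * y % x : ℕ) = t' * y % x := by
      rw [h5] at h4
      exact Nat.eq_of_mul_eq_mul_right hd (Nat.add_right_cancel h4)
    have h7 : t = t' := (bijective_mul_mod hx h).1 (Fin.ext h6)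
    rw [h3, h7, Fin.ext h5]
  · intro i
    have h0 : (0 : ℤ) < (d * x : ℕ) := by positivity
    have h1 := Int.emod_nonneg i h0.ne'
    have h2 := Int.emod_lt_of_pos i h0
    obtain ⟨w, hw⟩ := Int.eq_ofNat_of_zero_le h1
    rw [hw] at h2
    have h2' : w < d * x := by exact_mod_cast h2
    obtain ⟨t, ht⟩ := (bijective_mul_mod hx h).2 ⟨w / d, Nat.div_lt_of_lt_mul h2'⟩
    have ht' : (t : ℕ) * y % x = w / d := congrArg Fin.val ht
    refine ⟨⟨i / (d * x : ℕ), t, ⟨w % d, Nat.mod_lt _ hd⟩⟩, ?_⟩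
    simp only [orbitCoordinate]
    rw [ht']
    have h3 := Int.mul_ediv_add_emod i (d * x : ℕ)
    have h4 : ((w / d : ℕ) : ℤ) * d + (w % d : ℕ) = w := by
      exact_mod_cast Nat.div_add_mod' w d
    rw [hw] at h3
    linear_combination h3 + h4

/-- One step of the folded permutation in orbit coordinates. -/
theorem folded_step {d x y : ℕ} (hx : 0 < x) (k : ℤ) (t r : ℕ) (hr : r < d) (i : ℤ)
    (hi : i = k * (d * x : ℕ) + ((t * y % x : ℕ) : ℤ) * d + r) :
    ((d * y : ℕ) : ℤ) - (d * x : ℕ) - i + 2 * (i % (d * x : ℕ)) =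
      (-k - 1 + ((t * y % x + y) / x : ℕ)) * (d * x : ℕ) +
        (((t + 1) * y % x : ℕ) : ℤ) * d + r := by
  set z := t * y % x with hz
  have hzx : z < x := Nat.mod_lt _ hx
  have h1 : ((z * d + r : ℕ) : ℤ) < (d * x : ℕ) := by
    have : (z + 1) * d ≤ x * d := Nat.mul_le_mul_right d hzx
    have h' : z * d + r < d * x := by nlinarith
    exact_mod_cast h'
  have h2 : i = ((z * d + r : ℕ) : ℤ) + (d * x : ℕ) * k := by
    rw [hi]
    push_cast
    ring
  have h3 : i % (d * x : ℕ) = ((z * d + r : ℕ) : ℤ) := by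
    rw [h2, Int.add_mul_emod_self_left, Int.emod_eq_of_lt (by positivity) h1]
  have h4 : (t + 1) * y % x = (z + y) % x := by
    rw [hz, add_mul, one_mul, Nat.mod_add_mod]
  have h5 : (x : ℤ) * ((z + y) / x : ℕ) + ((z + y) % x : ℕ) = z + y := by
    exact_mod_cast Nat.div_add_mod (z + y) x
  rw [h3, h4, hi]
  push_cast at h5 ⊢
  linear_combination (-(d : ℤ)) * h5

/-- The residue r is never changed, which gives d independent copies. In each of them every orbit
meets position 0 of the rotation, so a function is determined by its values there, subject to
invariance under the return map after x steps. -/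
theorem finrank_foldedInvariants {d x y m n : ℕ} (hd : 0 < d) (hx : 0 < x) (h : Nat.Coprime x y)
    (e : affineInvariants m ((-1) ^ x) (foldingShift x y x) ≃ₗ[ℂ] (Fin n → ℂ)) :
    Module.finrank ℂ (foldedInvariants (d * x : ℕ) (d * y : ℕ) m) = d * n := by
  have horbit : ∀ ψ ∈ foldedInvariants (d * x : ℕ) (d * y : ℕ) m, ∀ (k : ℤ) (r : Fin d) (t : ℕ),
      ψ (k * (d * x : ℕ) + (r : ℕ)) = ψ (((-1) ^ t * k + foldingShift x y t) * (d * x : ℕ) +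
        ((t * y % x : ℕ) : ℤ) * d + (r : ℕ)) := by
    rintro ψ ⟨h1, h2⟩ k r t
    induction t with
    | zero => simp [foldingShift]
    | succ t ih =>
      rw [ih, ← h2, folded_step hx _ t r r.2 _ rfl, foldingShift]
      congr 4
      ring
  let T : foldedInvariants (d * x : ℕ) (d * y : ℕ) m →ₗ[ℂ]
      (Fin d → affineInvariants m ((-1) ^ x) (foldingShift x y x)) :=
    { toFun := fun ψ r => ⟨fun k => ψ.1 (k * (d * x : ℕ) + (r : ℕ)), by
        obtain ⟨ψ, hψ⟩ := ψ
        refine ⟨fun k => ?_, fun k => ?_⟩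
        · dsimp only
          rw [← hψ.1 (k * (d * x : ℕ) + (r : ℕ))]
          congr 1
          ring
        · dsimp only
          rw [horbit ψ hψ k r x, Nat.mul_mod_right]
          congr 1
          push_cast
          ring⟩
      map_add' := fun _ _ => rfl
      map_smul' := fun _ _ => rfl }
  let E := Equiv.ofBijective _ (bijective_orbitCoordinate hd hx h)
  have hsq : ∀ t : ℕ, ((-1 : ℤ) ^ t) * (-1) ^ t = 1 := fun t => by
    rw [← mul_pow]
    simp
  have hT : Function.Bijective T := by
    constructor
    · rintro ⟨ψ, hψ⟩ ⟨ψ', hψ'⟩ heq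
      ext i
      change ψ i = ψ' i
      obtain ⟨⟨k, t, r⟩, rfl⟩ := (bijective_orbitCoordinate hd hx h).2 i
      have h1 : k = (-1) ^ (t : ℕ) * ((-1) ^ (t : ℕ) * (k - foldingShift x y t)) +
          foldingShift x y t := by
        rw [← mul_assoc, hsq]
        ring
      simp only [orbitCoordinate]
      rw [h1, ← horbit ψ hψ, ← horbit ψ' hψ']
      exact congrFun (congrArg Subtype.val (congrFun heq r)) _
    · intro θ
      -- The inverse of t steps is applied to the block coordinate, bringing the point back to
      -- position 0.
      let Ψ : ℤ × Fin x × Fin d → ℂ := fun p =>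
        (θ p.2.2).1 ((-1) ^ (p.2.1 : ℕ) * (p.1 - foldingShift x y p.2.1))
      have hΨ : ∀ p, Ψ (E.symm (orbitCoordinate d x y p)) = Ψ p := fun p => by
        rw [show orbitCoordinate d x y p = E p from rfl, Equiv.symm_apply_apply]
      refine ⟨⟨fun i => Ψ (E.symm i), fun i => ?_, fun i => ?_⟩, ?_⟩
      · dsimp only
        obtain ⟨⟨k, t, r⟩, rfl⟩ := (bijective_orbitCoordinate hd hx h).2 i
        have h1 : orbitCoordinate d x y (k, t, r) + m * (d * x : ℕ) =
            orbitCoordinate d x y (k + m, t, r) := by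
          simp only [orbitCoordinate]
          ring
        rw [h1, hΨ, hΨ]
        simp only [Ψ]
        have hθ := (θ r).2.1
        rcases neg_one_pow_eq_or ℤ (t : ℕ) with h2 | h2
        · rw [h2, ← hθ (1 * (k - _))]
          refine congrArg (θ r).1 ?_
          ring
        · rw [h2, ← hθ (-1 * (k + m - _))]
          refine congrArg (θ r).1 ?_
          ring
      · dsimp only
        obtain ⟨⟨k, t, r⟩, rfl⟩ := (bijective_orbitCoordinate hd hx h).2 i
        rw [folded_step hx k t r r.2 (orbitCoordinate d x y (k, t, r)) rfl]
        by_cases ht : (t : ℕ) + 1 < x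
        · have h1 := hΨ (-k - 1 + ((t * y % x + y) / x : ℕ), ⟨t + 1, ht⟩, r)
          simp only [orbitCoordinate] at h1
          rw [h1, hΨ]
          simp only [Ψ, foldingShift]
          refine congrArg (θ r).1 ?_
          rw [pow_succ]
          ring
        -- The last position of the rotation: the next step closes the turn and uses the invariance
        -- of θ under the return map.
        · have ht' : (t : ℕ) + 1 = x := le_antisymm t.2 (not_lt.1 ht)
          have h1 := hΨ (-k - 1 + ((t * y % x + y) / x : ℕ), ⟨0, hx⟩, r)
          simp only [orbitCoordinate, zero_mul, Nat.zero_mod] at h1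
          rw [ht', Nat.mul_mod_right, h1, hΨ]
          simp only [Ψ, foldingShift, pow_zero, one_mul, sub_zero]
          rw [← (θ r).2.2 ((-1) ^ (t : ℕ) * (k - foldingShift x y t))]
          refine congrArg (θ r).1 ?_
          have h2 : foldingShift x y x =
              -foldingShift x y t - 1 + ((t * y % x + y) / x : ℕ) := by
            conv_lhs => rw [← ht', foldingShift]
            rw [ht']
          have h3 : (-1 : ℤ) ^ x = -(-1) ^ (t : ℕ) := by
            conv_lhs => rw [← ht', pow_succ]
            ring
          rw [h2, h3]
          linear_combination (k - foldingShift x y t) * hsq t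
      · funext r
        ext k
        change Ψ (E.symm (k * (d * x : ℕ) + (r : ℕ))) = (θ r).1 k
        have h1 := hΨ (k, ⟨0, hx⟩, r)
        simp only [orbitCoordinate, zero_mul, Nat.zero_mod, Nat.cast_zero, add_zero] at h1
        rw [h1]
        simp [Ψ, foldingShift]
  rw [(LinearEquiv.ofBijective T hT).finrank_eq, (LinearEquiv.piCongrRight fun _ => e).finrank_eq,
    Module.finrank_pi_fintype]
  simp

end Unfolding

/-! ### From the Lie algebra index to seaweeds, and the final count. -/

section Parabolic

/-- By cyclicity of the trace, f([x, y]) is the trace of (Fx - xF)y. -/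
theorem finrank_coadjointStabilizer_parabolic {n : ℕ} (c : Composition n)
    (f : Module.Dual ℂ (parabolic c)) (F : Matrix (Fin n) (Fin n) ℂ)
    (hf : ∀ x : parabolic c, f x = (F * x.1).trace) :
    Module.finrank ℂ (coadjointStabilizer ℂ f) =
      Module.finrank ℂ (incidenceStabilizer (fun i j => c.index i ≤ c.index j) F) := by
  have hmem : ∀ y : Matrix (Fin n) (Fin n) ℂ,
      y ∈ parabolic c ↔ ∀ i j, ¬ c.index i ≤ c.index j → y i j = 0 := by
    intro y
    constructor
    · intro h i j hij
      exact h (not_le.1 hij)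
    · intro h i j hij
      exact h i j (not_le.2 hij)
  have hlie : ∀ x y : parabolic c, f ⁅x, y⁆ = ((F * x.1 - x.1 * F) * y.1).trace := by
    intro x y
    rw [hf]
    have h1 : (⁅x, y⁆ : parabolic c).1 = x.1 * y.1 - y.1 * x.1 := rfl
    rw [h1, mul_sub, sub_mul, Matrix.trace_sub, Matrix.trace_sub, ← mul_assoc, ← mul_assoc,
      Matrix.trace_mul_comm (F * y.1), ← mul_assoc]
  have key : ∀ x : parabolic c, x ∈ coadjointStabilizer ℂ f ↔
      x.1 ∈ incidenceStabilizer (fun i j => c.index i ≤ c.index j) F := by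
    intro x
    constructor
    · intro hx
      refine ⟨(hmem _).1 x.2, fun i j hji => ?_⟩
      -- Testing against the matrix unit at (j, i) extracts the entry (i, j) of the commutator.
      have h1 := hx ⟨Matrix.single j i 1, (hmem _).2 fun k l hkl => by
        rw [Matrix.single_apply, if_neg]
        rintro ⟨rfl, rfl⟩
        exact hkl hji⟩
      rw [hlie, Matrix.trace_mul_single, MulOpposite.op_one, one_smul] at h1
      rw [Matrix.sub_apply] at h1 ⊢
      linear_combination -h1
    · rintro ⟨-, hx⟩ y
      rw [hlie, Matrix.trace]
      refine Finset.sum_eq_zero fun i _ => ?_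
      rw [Matrix.diag_apply, Matrix.mul_apply]
      refine Finset.sum_eq_zero fun j _ => ?_
      by_cases hji : c.index j ≤ c.index i
      · have h1 := hx i j hji
        rw [← neg_sub, Matrix.neg_apply, h1, neg_zero, zero_mul]
      · rw [(hmem y.1).1 y.2 j i hji, mul_zero]
  let T : coadjointStabilizer ℂ f →ₗ[ℂ]
      incidenceStabilizer (fun i j => c.index i ≤ c.index j) F :=
    { toFun := fun x => ⟨x.1.1, (key x.1).1 x.2⟩
      map_add' := fun _ _ => rfl
      map_smul' := fun _ _ => rfl }
  refine (LinearEquiv.ofBijective T ⟨?_, ?_⟩).finrank_eq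
  · intro x y h
    have h1 : (T x).1 = (T y).1 := by rw [h]
    exact Subtype.ext (Subtype.ext h1)
  · rintro ⟨x, hx⟩
    exact ⟨⟨⟨x, (hmem x).2 hx.1⟩, (key ⟨x, (hmem x).2 hx.1⟩).2 hx⟩, rfl⟩

theorem lieIndex_parabolic_eq {n k : ℕ} (c : Composition n)
    (h : HasIncidenceIndex (fun i j => c.index i ≤ c.index j) k) :
    lieIndex ℂ (parabolic c) = k := by
  obtain ⟨⟨F, hF⟩, h⟩ := h
  have hmatrix : ∀ f : Module.Dual ℂ (parabolic c), ∃ F : Matrix (Fin n) (Fin n) ℂ,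
      ∀ x : parabolic c, f x = (F * x.1).trace := by
    intro f
    -- A form on the subalgebra extends to all matrices, where the trace pairing is perfect.
    obtain ⟨g, hg⟩ := LinearMap.exists_extend (p := (parabolic c).toSubmodule) f
    refine ⟨Matrix.of fun j i => g (Matrix.single i j 1), fun x => ?_⟩
    have h1 : f x = g x.1 := (LinearMap.congr_fun hg x).symm
    rw [h1]
    conv_lhs => rw [Matrix.matrix_eq_sum_single x.1]
    simp only [map_sum, Matrix.trace, Matrix.diag_apply, Matrix.mul_apply, Matrix.of_apply]
    rw [Finset.sum_comm]
    refine Finset.sum_congr rfl fun j _ => Finset.sum_congr rfl fun i _ => ?_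
    rw [mul_comm, ← smul_eq_mul, ← map_smul, Matrix.smul_single, smul_eq_mul, mul_one]
  let f₀ : Module.Dual ℂ (parabolic c) :=
    Matrix.traceLinearMap (Fin n) ℂ ℂ ∘ₗ LinearMap.mulLeft ℂ F ∘ₗ (parabolic c).toSubmodule.subtype
  have hf₀ := finrank_coadjointStabilizer_parabolic c f₀ F fun x => rfl
  have hle : lieIndex ℂ (parabolic c) ≤ Module.finrank ℂ (coadjointStabilizer ℂ f₀) :=
    Nat.sInf_le ⟨f₀, rfl⟩
  refine le_antisymm (hle.trans (hf₀.trans_le hF)) (le_csInf ⟨_, f₀, rfl⟩ ?_)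
  rintro d ⟨f, rfl⟩
  obtain ⟨F', hF'⟩ := hmatrix f
  rw [finrank_coadjointStabilizer_parabolic c f F' hF']
  exact h F'

theorem sizeUpTo_repeatedComposition {a b m : ℕ} (ha : 0 < a) (hb : 0 < b) {k : ℕ} (hk : k ≤ m) :
    (repeatedComposition a b m ha hb).sizeUpTo k = k * a := by
  rw [Composition.sizeUpTo]
  simp [repeatedComposition, List.take_append, List.take_replicate, Nat.sub_eq_zero_of_le hk, hk]

theorem index_repeatedComposition {a b m : ℕ} (ha : 0 < a) (hb : 0 < b) (i : Fin (m * a + b)) :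
    ((repeatedComposition a b m ha hb).index i : ℕ) = if (i : ℕ) < m * a then (i : ℕ) / a else m := by
  set c := repeatedComposition a b m ha hb with hc
  have hlen : c.length = m + 1 := by
    rw [← c.blocks_length]
    simp [hc, repeatedComposition]
  have hsz : ∀ {k}, k ≤ m → c.sizeUpTo k = k * a := sizeUpTo_repeatedComposition ha hb
  have hk : (c.index i : ℕ) < m + 1 := (c.index i).2.trans_eq hlen
  have h1 := c.sizeUpTo_index_le i
  have h2 := c.lt_sizeUpTo_index_succ i
  rw [hsz (Nat.lt_succ_iff.1 hk)] at h1
  rcases Nat.lt_or_ge (c.index i) m with h | h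
  · rw [Fin.val_succ, hsz h] at h2
    have h3 : ((c.index i : ℕ) + 1) * a ≤ m * a := Nat.mul_le_mul_right a h
    rw [if_pos (h2.trans_le h3)]
    exact (Nat.div_eq_of_lt_le h1 h2).symm
  · have h3 : (c.index i : ℕ) = m := by omega
    rw [h3] at h1 ⊢
    rw [if_neg (not_lt.2 h1)]

theorem index_le_index_repeatedComposition_iff {a b m : ℕ} (ha : 0 < a) (hb : 0 < b)
    (i j : Fin (m * a + b)) :
    (repeatedComposition a b m ha hb).index i ≤ (repeatedComposition a b m ha hb).index j ↔
      seaweedRel (repeatedBlock a b m) (fun _ => (m : ℤ) * a + b - 1) (i : ℕ) (j : ℕ) := by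
  rw [Fin.le_def, index_repeatedComposition, index_repeatedComposition]
  have hcast : ∀ i : Fin (m * a + b), ((i : ℕ) : ℤ) < m * a ↔ (i : ℕ) < m * a := fun i => by
    norm_cast
  have hlt : ∀ i : Fin (m * a + b), (i : ℕ) < m * a → (i : ℕ) / a < m := fun i hi =>
    Nat.div_lt_of_lt_mul (hi.trans_eq (mul_comm m a))
  have hrb : ∀ i : Fin (m * a + b), (i : ℕ) < m * a → repeatedBlock a b m (i : ℕ) =
      (2 * (((i : ℕ) / a : ℕ) : ℤ) + 1) * a - 1 := fun i hi => by
    rw [repeatedBlock, if_pos ((hcast i).2 hi)]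
    push_cast
    rfl
  have hrb' : ∀ i : Fin (m * a + b), ¬ (i : ℕ) < m * a → repeatedBlock a b m (i : ℕ) =
      2 * ((m : ℤ) * a) + b - 1 := fun i hi => if_neg (mt (hcast i).1 hi)
  have hne : ∀ i : Fin (m * a + b), (i : ℕ) < m * a →
      (2 * (((i : ℕ) / a : ℕ) : ℤ) + 1) * a - 1 < 2 * ((m : ℤ) * a) + b - 1 := fun i hi => by
    have h1 : ((((i : ℕ) / a : ℕ) : ℤ) + 1) * a ≤ m * a := by
      exact_mod_cast Nat.mul_le_mul_right a (hlt i hi)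
    have h2 : (0 : ℤ) < a := by exact_mod_cast ha
    have h3 : (0 : ℤ) < b := by exact_mod_cast hb
    linarith
  have hmono : (i : ℕ) ≤ j → (i : ℕ) / a ≤ j / a := fun h => Nat.div_le_div_right h
  have hmono' : (j : ℕ) ≤ i → (j : ℕ) / a ≤ i / a := fun h => Nat.div_le_div_right h
  have ha' : (0 : ℤ) < a := by exact_mod_cast ha
  simp only [seaweedRel, and_true, Nat.cast_le]
  by_cases hi : (i : ℕ) < m * a <;> by_cases hj : (j : ℕ) < m * a
  · rw [if_pos hi, if_pos hj, hrb i hi, hrb j hj]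
    constructor
    · intro h
      rcases le_total (i : ℕ) j with h1 | h1
      · exact Or.inl h1
      · refine Or.inr ⟨h1, ?_⟩
        rw [le_antisymm h (hmono' h1)]
    · rintro (h | ⟨-, h⟩)
      · exact hmono h
      · have h1 := mul_right_cancel₀ ha'.ne' (sub_left_injective h)
        omega
  · rw [if_pos hi, if_neg hj]
    have := hlt i hi
    constructor <;> intro _ <;> omega
  · rw [if_neg hi, if_pos hj, hrb' i hi, hrb j hj]
    have := hlt j hj
    have := hne j hj
    constructor <;> intro h <;> omega
  · rw [if_neg hi, if_neg hj, hrb' i hi, hrb' j hj]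
    simp only [and_true, le_refl, true_iff]
    exact le_total _ _

theorem hasIncidenceIndex_repeatedComposition {a b m : ℕ} (ha : 0 < a) (hb : 0 < b) (hm : 0 < m) :
    HasIncidenceIndex (fun i j : Fin (m * a + b) =>
      (repeatedComposition a b m ha hb).index i ≤ (repeatedComposition a b m ha hb).index j)
      (Module.finrank ℂ (foldedInvariants a b m)) := by
  have ha' : (0 : ℤ) < a := by exact_mod_cast ha
  have hb' : (0 : ℤ) < b := by exact_mod_cast hb
  have hm' : (0 : ℤ) < m := by exact_mod_cast hm
  have h := hasIncidenceIndex_seaweed (m * a + b) 0 _ _ (isBlockSum_repeatedBlock ha' hb' hm')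
    (isBlockSum_const _) (by push_cast; omega)
  rw [finrank_seaweedInvariants_repeatedBlock ha' hb' hm'] at h
  let e : Fin (m * a + b) ≃ Set.Ico (0 : ℤ) (m * a + b) :=
    { toFun := fun i => ⟨(i : ℕ), by positivity, by exact_mod_cast i.2⟩
      invFun := fun i => ⟨(i : ℤ).toNat, by
        have h1 := i.2.1
        have h2 := i.2.2
        zify
        omega⟩
      left_inv := fun i => by simp
      right_inv := fun i => Subtype.ext (Int.toNat_of_nonneg i.2.1) }
  exact h.reindex e fun i j => index_le_index_repeatedComposition_iff ha hb i j

/-- For x odd, the shift is written as 2c - ε with ε = 0 or 1 according as y is odd or even; the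
orbit count (m - ε)/2 + 1 is then the value of `phi`. -/
theorem finrank_foldedInvariants_eq {d x y m : ℕ} (hd : 0 < d) (hx : 0 < x) (hm : 0 < m)
    (h : Nat.Coprime x y) :
    Module.finrank ℂ (foldedInvariants (d * x : ℕ) (d * y : ℕ) m) = d * phi m x y := by
  have key : Nonempty (affineInvariants m ((-1) ^ x) (foldingShift x y x) ≃ₗ[ℂ]
      (Fin (phi m x y) → ℂ)) := by
    rcases Nat.even_or_odd x with hxe | hxo
    · have hyo : Odd y := by
        rw [← Nat.not_even_iff_odd]
        intro hye
        have := Nat.dvd_gcd hxe.two_dvd hye.two_dvd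
        rw [h] at this
        omega
      rw [phi, if_neg (Nat.not_odd_iff_even.2 hxe), hxe.neg_one_pow,
        foldingShift_self_of_even hx hxe hyo h]
      exact nonempty_affineInvariants_one_equiv m
    · obtain ⟨q, hq⟩ := foldingShift_parity x y x
      rw [Nat.mul_div_cancel_left y hx] at hq
      obtain ⟨u, hu⟩ := hxo
      rw [phi, if_pos ⟨u, hu⟩, Odd.neg_one_pow ⟨u, hu⟩]
      rcases Nat.even_or_odd y with ⟨v, hv⟩ | ⟨v, hv⟩
      · rw [if_neg (Nat.not_odd_iff_even.2 ⟨v, hv⟩)]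
        have h1 : foldingShift x y x = 2 * (u + v + q + 1) - (1 : ℕ) := by
          rw [hq, hu, hv]
          push_cast
          ring
        have h2 : (m + 1) / 2 = (m - 1) / 2 + 1 := by omega
        rw [h1, h2]
        exact nonempty_affineInvariants_neg_one_equiv hm _ le_rfl
      · rw [if_pos ⟨v, hv⟩]
        have h1 : foldingShift x y x = 2 * (u + v + q + 1) - (0 : ℕ) := by
          rw [hq, hu, hv]
          push_cast
          ring
        rw [h1]
        exact nonempty_affineInvariants_neg_one_equiv hm _ zero_le_one
  obtain ⟨e⟩ := key
  exact finrank_foldedInvariants hd hx h e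

end Parabolic

theorem mainTheorem1 (a b m : ℕ) (ha : 0 < a) (hb : 0 < b) (hm : 0 < m) :
    lieIndex ℂ (parabolic (repeatedComposition a b m ha hb)) =
      Nat.gcd a b * phi m (a / Nat.gcd a b) (b / Nat.gcd a b) := by
  have hd : 0 < Nat.gcd a b := Nat.gcd_pos_of_pos_left b ha
  have hx : 0 < a / Nat.gcd a b :=
    Nat.div_pos (Nat.le_of_dvd ha (Nat.gcd_dvd_left a b)) hd
  rw [lieIndex_parabolic_eq _ (hasIncidenceIndex_repeatedComposition ha hb hm),
    ← finrank_foldedInvariants_eq hd hx hm (Nat.coprime_div_gcd_div_gcd hd),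
    Nat.mul_div_cancel' (Nat.gcd_dvd_left a b), Nat.mul_div_cancel' (Nat.gcd_dvd_right a b)]
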